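/- Let $S,A$ be finite non-empty sets and consider a Markov decision process with transition probabilities $p^j_{ia}$, real rewards $r^j_{ia}$ ($i,j\in S$, $a\in A$) and discount factor $\gamma\in[0,1)$. Let $0<w\le w^*:=\min_{i,a}\frac{1}{1-\gamma p^i_{ia}}$, and fix a measurable tie-breaking rule, so that for every $q\in\mathbb R^A$ the expression $\arg\max_b q(b)$ denotes one definite maximiser of $q$. Double SOR Q-learning with constant parameter $w$ produces random tables $\widetilde Q^A_n,\widetilde Q^B_n\in\mathbb R^{S\times A}$, $n\ge 0$, from integrable initial tables $\widetilde Q^A_0,\widetilde Q^B_0$. At time $n$ the agent is in state $i_n$ and plays an action $a_n$, chosen by any (possibly randomised, history-dependent) behaviour policy; step sizes $\beta_n(i,a)\in[0,1]$ depending on the history up to the choice of $a_n$ are given. Conditionally on this history, the next state $i_{n+1}$ has law $p^{\,\cdot}_{i_na_n}$ and, independently of it, a fair coin is tossed. Write $i=i_n$, $a=a_n$, $j=i_{n+1}$, $\beta_n=\beta_n(i_n,a_n)$. If the coin shows "$A$", then $$\widetilde Q^A_{n+1}(i,a)=(1-\beta_n)\widetilde Q^A_n(i,a)+\beta_n\big[w(r^j_{ia}+\gamma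 \widetilde Q^B_n(j,b^*))+(1-w)\widetilde Q^B_n(i,c^*)\big],$$ with $b^*=\arg\max_b\widetilde Q^A_n(j,b)$, $c^*=\arg\max_c\widetilde Q^A_n(i,c)$; otherwise $$\widetilde Q^B_{n+1}(i,a)=(1-\beta_n)\widetilde Q^B_n(i,a)+\beta_n\big[w(r^j_{ia}+\gamma \widetilde Q^A_n(j,d^*))+(1-w)\widetilde Q^A_n(i,e^*)\big],$$ with $d^*=\arg\max_d\widetilde Q_n(j,d)$, $e^*=\arg\max_e\widetilde Q_n(i,e)$, where $\widetilde Q_n$ is throughout $\widetilde Q^A_n$ in one variant of the algorithm and throughout $\widetilde Q^B_n$ in the other. All other entries of the two tables are left unchanged. Assume that with probability one, for every $(i,a)\in S\times A$, the step sizes used for the pair $(i,a)$ satisfy $$\sum_{n:\,(i_n,a_n)=(i,a)}\beta_n(i,a)=\infty,\qquad \sum_{n:\,(i_n,a_n)=(i,a)}\beta_n(i,a)^2<\infty$$ (in particular every pair is visited infinitely often). Let $V^{BA}_n(i,a):=\widetilde Q^B_n(i,a)-\widetilde Q^A_n(i,a)$, and let $(\mathcal G_n)_{n\ge0}$ be the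 filtration $\mathcal G_n=\sigma(\widetilde Q^A_0,\widetilde Q^B_0,i_k,a_k,\beta_k:\,k\le n)$ or any larger filtration (for instance the one that also contains the coin tosses before time $n$, for which $V^{BA}_n$ is $\mathcal G_n$-measurable). Then, for both variants of the algorithm and every $(i,a)\in S\times A$, each $V^{BA}_n(i,a)$ is integrable and $$\mathbb E\big[V^{BA}_n(i,a)\,\big|\,\mathcal G_n\big]\longrightarrow 0\quad\text{as } n\to\infty,\ \text{with probability one.}$$ -/

import Mathlib

open MeasureTheory ProbabilityTheory Filter
open scoped Topology

/-- A finite discounted Markov decision process: `p i a j` is the probability of moving to `j`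
when `a` is played in `i`, and `r i a j` the reward received on that transition. -/
structure FiniteMDP (S A : Type*) [Fintype S] where
  p : S → A → S → ℝ
  r : S → A → S → ℝ
  γ : ℝ
  p_nonneg : ∀ i a j, 0 ≤ p i a j
  p_sum : ∀ i a, ∑ j, p i a j = 1
  γ_nonneg : 0 ≤ γ
  γ_lt_one : γ < 1

/-- The largest admissible relaxation parameter, `w* = min_{i,a} 1 / (1 - γ p(i | i, a))`. -/
noncomputable def FiniteMDP.wStar {S A : Type*} [Fintype S] (M : FiniteMDP S A) : ℝ :=
  ⨅ x : S × A, 1 / (1 - M.γ * M.p x.1 x.2 x.1)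

/-- A (measurable) rule picking a maximiser of a function on the action set. -/
structure IsArgmaxRule {A : Type*} (g : (A → ℝ) → A) : Prop where
  le_max : ∀ (q : A → ℝ) (a : A), q a ≤ q (g q)
  measurable_level : ∀ a : A, MeasurableSet {q : A → ℝ | g q = a}

/-- The two tables `(Q^A, Q^B)` of the algorithm. -/
abbrev TablePair (S A : Type*) := (S → A → ℝ) × (S → A → ℝ)

/-- One relaxed update of the entry `(i, a)` of the table `Q`, on a transition to `j` and with
step size `β`. The next and the current action are chosen greedily from the table `Qsel` and
evaluated with the table `Qeval`; all other entries are kept. -/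
noncomputable def relaxedUpdate {S A : Type*} [Fintype S] [DecidableEq S] [DecidableEq A]
    (M : FiniteMDP S A) (w : ℝ) (g : (A → ℝ) → A) (Q Qsel Qeval : S → A → ℝ)
    (i : S) (a : A) (j : S) (β : ℝ) : S → A → ℝ :=
  fun s u =>
    if s = i ∧ u = a then
      (1 - β) * Q i a +
        β * (w * (M.r i a j + M.γ * Qeval j (g (Qsel j))) + (1 - w) * Qeval i (g (Qsel i)))
    else Q s u

/-- One step of double SOR Q-learning. If `coin = true`, the table `A` is updated: actions are
selected with `Q^A` and evaluated with `Q^B`. If `coin = false`, the table `B` is updated: actions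
are evaluated with `Q^A`, and selected with `Q^B` if `selB = true`, with `Q^A` if
`selB = false`. -/
noncomputable def dsorStep {S A : Type*} [Fintype S] [DecidableEq S] [DecidableEq A]
    (M : FiniteMDP S A) (w : ℝ) (g : (A → ℝ) → A) (selB : Bool) (Q : TablePair S A)
    (i : S) (a : A) (j : S) (β : ℝ) (coin : Bool) : TablePair S A :=
  if coin = true then
    (relaxedUpdate M w g Q.1 Q.1 Q.2 i a j β, Q.2)
  else
    (Q.1, relaxedUpdate M w g Q.2 (if selB = true then Q.2 else Q.1) Q.1 i a j β)

/-- The iterates `n ↦ (Q^A_n, Q^B_n)` of double SOR Q-learning along the states `X n`, the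
actions `U n`, the step sizes `β n` and the coin tosses `coin n`. -/
noncomputable def dsorIterate {Ω S A : Type*} [Fintype S] [DecidableEq S] [DecidableEq A]
    (M : FiniteMDP S A) (w : ℝ) (g : (A → ℝ) → A) (selB : Bool) (Q₀ : Ω → TablePair S A)
    (X : ℕ → Ω → S) (U : ℕ → Ω → A) (β : ℕ → Ω → S → A → ℝ) (coin : ℕ → Ω → Bool) :
    ℕ → Ω → TablePair S A
  | 0, ω => Q₀ ω
  | n + 1, ω =>
      dsorStep M w g selB (dsorIterate M w g selB Q₀ X U β coin n ω)
        (X n ω) (U n ω) (X (n + 1) ω) (β n ω (X n ω) (U n ω)) (coin n ω)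

/-- The step size effectively applied to the entry `(i, a)` at time `n`: it is `0` unless
`(i, a)` is the pair visited at time `n`. -/
def visitStep {Ω S A : Type*} [DecidableEq S] [DecidableEq A]
    (X : ℕ → Ω → S) (U : ℕ → Ω → A) (β : ℕ → Ω → S → A → ℝ)
    (n : ℕ) (ω : Ω) (i : S) (a : A) : ℝ :=
  if X n ω = i ∧ U n ω = a then β n ω i a else 0

/-- The sampling mechanism of double SOR Q-learning. `ℱ n` is the history up to the choice of the
action at time `n`; the behaviour policy and the step sizes may depend on it in any way. Given
`ℱ n`, the next state is drawn from the transition kernel and, independently of it, a fair coin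
decides which of the two tables is updated. -/
structure IsDSORSampling {Ω S A : Type*} [mΩ : MeasurableSpace Ω] [Fintype S]
    (M : FiniteMDP S A) (μ : Measure Ω) (ℱ : Filtration ℕ mΩ) (Q₀ : Ω → TablePair S A)
    (X : ℕ → Ω → S) (U : ℕ → Ω → A) (β : ℕ → Ω → S → A → ℝ) (coin : ℕ → Ω → Bool) : Prop where
  init_measurable : ∀ i a, Measurable[ℱ 0] (fun ω => (Q₀ ω).1 i a) ∧
    Measurable[ℱ 0] (fun ω => (Q₀ ω).2 i a)
  init_integrable : ∀ i a, Integrable (fun ω => (Q₀ ω).1 i a) μ ∧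
    Integrable (fun ω => (Q₀ ω).2 i a) μ
  state_adapted : ∀ n i, MeasurableSet[ℱ n] {ω | X n ω = i}
  action_adapted : ∀ n a, MeasurableSet[ℱ n] {ω | U n ω = a}
  step_adapted : ∀ n i a, Measurable[ℱ n] (fun ω => β n ω i a)
  coin_adapted : ∀ n c, MeasurableSet[ℱ (n + 1)] {ω | coin n ω = c}
  transition : ∀ n j c,
    μ[{ω | X (n + 1) ω = j ∧ coin n ω = c}.indicator (fun _ => (1 : ℝ)) | ℱ n]
      =ᵐ[μ] fun ω => M.p (X n ω) (U n ω) j * (1 / 2)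

/-- The σ-algebra generated by `Q^A_0`, `Q^B_0` and the `X k`, `U k`, `β k` with `k ≤ n`. -/
def observedSigma {Ω S A : Type*} (Q₀ : Ω → TablePair S A)
    (X : ℕ → Ω → S) (U : ℕ → Ω → A) (β : ℕ → Ω → S → A → ℝ) (n : ℕ) : MeasurableSpace Ω :=
  MeasurableSpace.generateFrom
    ({s | ∃ i a t, MeasurableSet t ∧ s = {ω | (Q₀ ω).1 i a ∈ t}} ∪
     {s | ∃ i a t, MeasurableSet t ∧ s = {ω | (Q₀ ω).2 i a ∈ t}} ∪
     {s | ∃ k ≤ n, ∃ i, s = {ω | X k ω = i}} ∪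
     {s | ∃ k ≤ n, ∃ a, s = {ω | U k ω = a}} ∪
     {s | ∃ k ≤ n, ∃ i a, ∃ t : Set ℝ, MeasurableSet t ∧ s = {ω | β k ω i a ∈ t}})

/-- The filtration formed by the σ-algebras `observedSigma`. -/
def IsDSORSampling.observed {Ω S A : Type*} [mΩ : MeasurableSpace Ω] [Fintype S]
    {M : FiniteMDP S A} {μ : Measure Ω} {ℱ : Filtration ℕ mΩ} {Q₀ : Ω → TablePair S A}
    {X : ℕ → Ω → S} {U : ℕ → Ω → A} {β : ℕ → Ω → S → A → ℝ} {coin : ℕ → Ω → Bool}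
    (h : IsDSORSampling M μ ℱ Q₀ X U β coin) : Filtration ℕ mΩ where
  seq := observedSigma Q₀ X U β
  mono' := by
    intro m n hmn
    refine MeasurableSpace.generateFrom_mono ?_
    rintro s ((((hs | hs) | ⟨k, hk, hs⟩) | ⟨k, hk, hs⟩) | ⟨k, hk, hs⟩)
    · exact Or.inl (Or.inl (Or.inl (Or.inl hs)))
    · exact Or.inl (Or.inl (Or.inl (Or.inr hs)))
    · exact Or.inl (Or.inl (Or.inr ⟨k, hk.trans hmn, hs⟩))
    · exact Or.inl (Or.inr ⟨k, hk.trans hmn, hs⟩)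
    · exact Or.inr ⟨k, hk.trans hmn, hs⟩
  le' := by
    intro n
    refine MeasurableSpace.generateFrom_le ?_
    rintro s ((((⟨i, a, t, ht, rfl⟩ | ⟨i, a, t, ht, rfl⟩) | ⟨k, -, i, rfl⟩) | ⟨k, -, a, rfl⟩) |
      ⟨k, -, i, a, t, ht, rfl⟩)
    · exact ℱ.le 0 _ ((h.init_measurable i a).1 ht)
    · exact ℱ.le 0 _ ((h.init_measurable i a).2 ht)
    · exact ℱ.le k _ (h.state_adapted k i)
    · exact ℱ.le k _ (h.action_adapted k a)
    · exact ℱ.le k _ (h.step_adapted k i a ht)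

/-! ### Deterministic estimates -/

/-! Stack the two tables into one vector `x`. Averaging over the coin and the next state turns the
algorithm into a stochastic relaxation: at the visited pair both tables move with weight `β / 2`
towards their mean targets, plus a martingale difference. The condition `w ≤ w*` makes every weight
in the SOR average nonnegative, so that average has modulus `κ = 1 - w * (1 - γ) < 1`. In the
difference of the tables the rewards cancel, and the greedy values differ by at most the distance of
the tables, in either variant (`abs_meanTarget_sub_le`). The difference is thus a relaxation
contracted towards `0`, and it vanishes once the tables stay bounded and the noise series converges
(`tendsto_zero_of_contraction`).

Boundedness and noise are treated together, because the noise grows with `‖x‖`. Pathwise, `(1 - κ)`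
times the running maximum is at most a constant plus twice the maximal accumulated noise. Doob's
inequality bounds the second moment of the latter by the sum of squared steps times the second
moment of the running maximum itself. If that sum is small after some time `N`, the term is absorbed
(`integral_sq_runningMax_le`); this gives an integrable bound for the whole path and an `L²`-bounded
noise martingale.

Smallness is obtained by localisation: steps are set to `0` once the squared steps after `N` exceed
`ε`, and large initial tables are replaced by `0`. On the localised paths dominated convergence of
conditional expectations (Hunt's lemma, `tendsto_condExp_of_dominated`) applies. The local events
are decreasing and observable in `𝒢`, so their indicators leave the conditional expectation, and
almost every path stays forever in one of countably many of them. -/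

lemma abs_convexComb_le {a y z c : ℝ} (h0 : 0 ≤ a) (h1 : a ≤ 1) (hy : |y| ≤ c) (hz : |z| ≤ c) :
    |(1 - a) * y + a * z| ≤ c := by
  rw [abs_le] at *
  constructor <;> nlinarith

/-- A relaxation scheme whose accumulated noise stays below `δ` exceeds the bound on its
initial value and its targets by at most `2 * δ`. -/
lemma abs_le_of_relaxation {N T : ℕ} {x a f d m : ℕ → ℝ} {c δ : ℝ}
    (ha : ∀ k, 0 ≤ a k ∧ a k ≤ 1)
    (hx : ∀ k, N ≤ k → x (k + 1) = (1 - a k) * x k + a k * f k + d k)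
    (hm : ∀ k, N ≤ k → m (k + 1) = m k + d k) (hmN : m N = 0)
    (hf : ∀ k, N ≤ k → k < T → |f k| ≤ c) (hxN : |x N| ≤ c)
    (hδ : ∀ k, N ≤ k → k ≤ T → |m k| ≤ δ) :
    ∀ n, N ≤ n → n ≤ T → |x n| ≤ c + 2 * δ := by
  -- Subtracting the accumulated noise leaves a noise-free relaxation of `x - m` towards `f - m`.
  -- The second `δ` is paid when `m` is added back.
  have key : ∀ n, N ≤ n → n ≤ T → |x n - m n| ≤ c + δ := by
    intro n hn
    induction n, hn using Nat.le_induction with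
    | base =>
      intro hT
      have := (abs_nonneg _).trans (hδ N le_rfl hT)
      rw [hmN, sub_zero]; linarith
    | succ n hn ih =>
      intro hT
      have e : x (n + 1) - m (n + 1) = (1 - a n) * (x n - m n) + a n * (f n - m n) := by
        rw [hx n hn, hm n hn]; ring
      rw [e]
      refine abs_convexComb_le (ha n).1 (ha n).2 (ih (by omega)) ?_
      exact (abs_sub _ _).trans (add_le_add (hf n hn (by omega)) (hδ n hn (by omega)))
  intro n hn hT
  have h1 := key n hn hT
  have h2 := hδ n hn hT
  have h3 := abs_add_le (x n - m n) (m n)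
  rw [sub_add_cancel] at h3
  linarith

/-- Relaxation with divergent total step size forgets its initial value. -/
lemma eventually_abs_le_of_relaxation {y a g : ℕ → ℝ} {c η : ℝ} (hc : 0 ≤ c) (hη : 0 < η)
    (ha : ∀ k, 0 ≤ a k ∧ a k ≤ 1)
    (hsum : Tendsto (fun N => ∑ k ∈ Finset.range N, a k) atTop atTop)
    (hy : ∀ k, y (k + 1) = (1 - a k) * y k + a k * g k)
    (hg : ∀ᶠ k in atTop, |g k| ≤ c) : ∀ᶠ k in atTop, |y k| ≤ c + η := by
  obtain ⟨m, hm⟩ := eventually_atTop.1 hg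
  set u : ℝ := |y m| with hu
  -- The excess over `c` shrinks by `1 - a n ≤ exp (-a n)` at each step, and the exponents add up to
  -- a divergent sum.
  have hdec : ∀ n, m ≤ n → |y n| ≤
      c + u * Real.exp (-(∑ k ∈ Finset.range n, a k - ∑ k ∈ Finset.range m, a k)) := by
    intro n hn
    induction n, hn using Nat.le_induction with
    | base => simp [hu, hc]
    | succ n hn ih =>
      rw [hy n, Finset.sum_range_succ]
      set E := Real.exp (-(∑ k ∈ Finset.range n, a k - ∑ k ∈ Finset.range m, a k)) with hE
      have e1 : Real.exp (-(∑ k ∈ Finset.range n, a k + a n - ∑ k ∈ Finset.range m, a k))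
          = E * Real.exp (-a n) := by
        rw [hE, ← Real.exp_add]; congr 1; ring
      rw [e1]
      have h1 : 1 - a n ≤ Real.exp (-a n) := by
        have := Real.add_one_le_exp (-a n); linarith
      have hE0 : 0 ≤ u * E := mul_nonneg (abs_nonneg _) (Real.exp_pos _).le
      have h2 := abs_add_le ((1 - a n) * y n) (a n * g n)
      rw [abs_mul, abs_mul, abs_of_nonneg (ha n).1, abs_of_nonneg (sub_nonneg.2 (ha n).2)] at h2
      have h3 := mul_le_mul_of_nonneg_left ih (sub_nonneg.2 (ha n).2)
      have h4 := mul_le_mul_of_nonneg_left (hm n hn) (ha n).1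
      have h5 := mul_le_mul_of_nonneg_left h1 hE0
      nlinarith
  have hlim : Tendsto (fun n => u * Real.exp (-(∑ k ∈ Finset.range n, a k -
      ∑ k ∈ Finset.range m, a k))) atTop (𝓝 0) := by
    have h1 : Tendsto (fun n => ∑ k ∈ Finset.range n, a k - ∑ k ∈ Finset.range m, a k)
        atTop atTop := tendsto_atTop_add_const_right _ _ hsum
    simpa using (Real.tendsto_exp_neg_atTop_nhds_zero.comp h1).const_mul u
  filter_upwards [eventually_ge_atTop m, hlim.eventually_lt_const hη] with n hn h
  linarith [hdec n hn]

/-- A relaxation scheme whose targets are contracted towards `0` tends to `0` when the noise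
series converges and the total step sizes diverge. -/
lemma tendsto_zero_of_contraction {ι : Type*} [Fintype ι] {v : ℕ → ι → ℝ}
    {a f d : ℕ → ι → ℝ} {κ R : ℝ} (hκ0 : 0 ≤ κ) (hκ1 : κ < 1)
    (ha : ∀ k i, 0 ≤ a k i ∧ a k i ≤ 1)
    (hsum : ∀ i, Tendsto (fun N => ∑ k ∈ Finset.range N, a k i) atTop atTop)
    (hv : ∀ k i, v (k + 1) i = (1 - a k i) * v k i + a k i * f k i + d k i)
    (hf : ∀ k i, |f k i| ≤ κ * ‖v k‖)
    (hd : ∀ i, ∃ l, Tendsto (fun n => ∑ k ∈ Finset.range n, d k i) atTop (𝓝 l))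
    (hR : ∀ k, ‖v k‖ ≤ R) : Tendsto v atTop (𝓝 0) := by
  have step : ∀ D η : ℝ, 0 ≤ D → 0 < η → (∀ᶠ k in atTop, ‖v k‖ ≤ D) →
      ∀ᶠ k in atTop, ‖v k‖ ≤ κ * D + η := by
    intro D η hD hη hev
    have hi : ∀ i, ∀ᶠ k in atTop, |v k i| ≤ κ * D + η := by
      intro i
      obtain ⟨l, hl⟩ := hd i
      -- Centred at its limit, the accumulated noise tends to `0`, and `v - m` relaxes towards `f -
      -- m` without noise. The three parts of `η` pay for `m` in the target, the forgotten initial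
      -- value, and `m` added back.
      set m : ℕ → ℝ := fun n => ∑ k ∈ Finset.range n, d k i - l with hm
      have hm0 : Tendsto m atTop (𝓝 0) := by simpa using hl.sub_const l
      have hme : ∀ᶠ k in atTop, |m k| ≤ η / 3 := by
        have := hm0.abs
        rw [abs_zero] at this
        exact this.eventually_le_const (by positivity)
      have hy : ∀ᶠ k in atTop, |v k i - m k| ≤ κ * D + η / 3 + η / 3 := by
        refine eventually_abs_le_of_relaxation (a := fun k => a k i)
          (g := fun k => f k i - m k) (by positivity) (by positivity)
          (fun k => ha k i) (hsum i) (fun k => ?_) ?_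
        · simp only [hm, Finset.sum_range_succ, hv k i]; ring
        · filter_upwards [hev, hme] with k h1 h2
          have := mul_le_mul_of_nonneg_left h1 hκ0
          exact (abs_sub _ _).trans (add_le_add ((hf k i).trans this) h2)
      filter_upwards [hy, hme] with k h1 h2
      have h3 := abs_add_le (v k i - m k) (m k)
      rw [sub_add_cancel] at h3
      linarith
    filter_upwards [eventually_all.2 hi] with k hk
    exact (pi_norm_le_iff_of_nonneg (by positivity)).2 hk
  set I : Set ℝ := {D | 0 ≤ D ∧ ∀ᶠ k in atTop, ‖v k‖ ≤ D} with hI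
  have hIne : I.Nonempty :=
    ⟨R, (norm_nonneg _).trans (hR 0), Eventually.of_forall hR⟩
  have hIbdd : BddBelow I := ⟨0, fun D hD => hD.1⟩
  have hL0 : 0 ≤ sInf I := le_csInf hIne fun D hD => hD.1
  have hL : sInf I ≤ 0 := by
    by_contra! hpos
    set L := sInf I
    -- `L` is the infimum of the eventual bounds. One contraction from a bound `D` slightly above
    -- `L` would produce an eventual bound below `L`.
    have hη : 0 < (1 - κ) * L / 4 := by
      have : 0 < 1 - κ := by linarith
      positivity
    obtain ⟨D, hD, hDL⟩ := exists_lt_of_csInf_lt hIne (show L < L + (1 - κ) * L / 4 by linarith)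
    have h1 := step D _ hD.1 hη hD.2
    have h2 : L ≤ κ * D + (1 - κ) * L / 4 :=
      csInf_le hIbdd ⟨by have := hD.1; positivity, h1⟩
    nlinarith
  rw [tendsto_zero_iff_norm_tendsto_zero, Metric.tendsto_atTop']
  intro η hη
  obtain ⟨D, hD, hDL⟩ := exists_lt_of_csInf_lt hIne (hL.trans_lt hη)
  obtain ⟨n, hn⟩ := eventually_atTop.1 hD.2
  refine ⟨n, fun k hk => ?_⟩
  rw [Real.dist_eq, sub_zero, abs_norm]
  exact (hn k hk.le).trans_lt hDL

/-- Pathwise form of Doob's maximal inequality in `L²`. -/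
lemma sq_partialSups_le (s : ℕ → ℝ) (h0 : s 0 = 0) (T : ℕ) :
    1 / 4 * partialSups s T ^ 2 + ∑ k ∈ Finset.range T, partialSups s k * (s (k + 1) - s k)
      ≤ s T ^ 2 := by
  -- Summation by parts: the maximum moves only when `s` reaches a new record, and the slack then
  -- gained is half the squared jump. The `1 / 4` in the conclusion comes from completing the square
  -- in `partialSups s T * s T`.
  have key : ∑ k ∈ Finset.range T, partialSups s k * (s (k + 1) - s k)
      ≤ partialSups s T * s T - 1 / 2 * partialSups s T ^ 2 := by
    induction T with
    | zero => simp [h0]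
    | succ T ih =>
      rw [Finset.sum_range_succ, partialSups_add_one]
      rcases le_total (s (T + 1)) (partialSups s T) with h | h
      · rw [sup_eq_left.2 h]; linarith
      · rw [sup_eq_right.2 h]; nlinarith [sq_nonneg (s (T + 1) - partialSups s T)]
  nlinarith [sq_nonneg (1 / 2 * partialSups s T - s T)]

/-! ### Conditional expectations -/

/-- **Hunt's lemma** with limit `0`: dominated almost sure convergence passes to conditional
expectations along a filtration. -/
lemma tendsto_condExp_of_dominated {Ω : Type*} [mΩ : MeasurableSpace Ω] {μ : Measure Ω}
    [IsFiniteMeasure μ] (𝒢 : Filtration ℕ mΩ) {v : ℕ → Ω → ℝ} {Y : Ω → ℝ}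
    (hv : ∀ n, AEMeasurable (v n) μ) (hY : Integrable Y μ)
    (hle : ∀ᵐ ω ∂μ, ∀ n, |v n ω| ≤ Y ω)
    (hlim : ∀ᵐ ω ∂μ, Tendsto (fun n => v n ω) atTop (𝓝 0)) :
    ∀ᵐ ω ∂μ, Tendsto (fun n => (μ[v n | 𝒢 n]) ω) atTop (𝓝 0) := by
  -- For fixed `m`, the conditional expectations of `v n` with `n ≥ m` are dominated by those of `Z
  -- m`, which converge by Lévy's upward theorem; letting `m` grow then sends the bound to `0`.
  set Z : ℕ → Ω → ℝ := fun m ω => ⨆ n, |v (m + n) ω| with hZ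
  have hZm : ∀ m, AEMeasurable (Z m) μ := fun m =>
    AEMeasurable.iSup fun n => (hv (m + n)).abs
  have hbdd : ∀ᵐ ω ∂μ, ∀ m, BddAbove (Set.range fun n => |v (m + n) ω|) := by
    filter_upwards [hle] with ω h m
    exact ⟨Y ω, by rintro _ ⟨n, rfl⟩; exact h _⟩
  have hZ0 : ∀ m ω, 0 ≤ Z m ω := fun m ω => Real.iSup_nonneg fun n => abs_nonneg _
  have hZY : ∀ᵐ ω ∂μ, ∀ m, Z m ω ≤ Y ω := by
    filter_upwards [hle] with ω h m
    exact ciSup_le fun n => h _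
  have hvZ : ∀ᵐ ω ∂μ, ∀ m n, m ≤ n → |v n ω| ≤ Z m ω := by
    filter_upwards [hbdd] with ω h m n hmn
    have := le_ciSup (h m) (n - m)
    simpa [Nat.add_sub_cancel' hmn] using this
  have hZint : ∀ m, Integrable (Z m) μ := fun m => by
    refine hY.mono' (hZm m).aestronglyMeasurable ?_
    filter_upwards [hZY] with ω h
    rw [Real.norm_eq_abs, abs_of_nonneg (hZ0 m ω)]
    exact h m
  have hanti : ∀ᵐ ω ∂μ, Antitone fun m => Z m ω := by
    filter_upwards [hvZ] with ω h m n hmn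
    exact ciSup_le fun k => h m (n + k) (by omega)
  have hZlim : ∀ᵐ ω ∂μ, Tendsto (fun m => Z m ω) atTop (𝓝 0) := by
    filter_upwards [hlim] with ω h
    rw [Metric.tendsto_atTop] at h ⊢
    intro ε hε
    obtain ⟨N, hN⟩ := h (ε / 2) (by positivity)
    refine ⟨N, fun n hn => ?_⟩
    rw [Real.dist_eq, sub_zero, abs_of_nonneg (hZ0 n ω)]
    refine lt_of_le_of_lt (ciSup_le fun k => ?_) (half_lt_self hε)
    have := hN (n + k) (by omega)
    rw [Real.dist_eq, sub_zero] at this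
    exact this.le
  set mlim : MeasurableSpace Ω := ⨆ n, 𝒢 n
  have hm_le : mlim ≤ mΩ := iSup_le fun n => 𝒢.le n
  have hint0 : Tendsto (fun m => ∫ ω, Z m ω ∂μ) atTop (𝓝 0) := by
    have := tendsto_integral_of_dominated_convergence (μ := μ) Y (F := Z) (f := fun _ => 0)
      (fun m => (hZm m).aestronglyMeasurable) hY (fun m => by
        filter_upwards [hZY] with ω h
        rw [Real.norm_eq_abs, abs_of_nonneg (hZ0 m ω)]
        exact h m) hZlim
    simpa using this
  -- A decreasing nonnegative sequence whose integrals tend to `0` tends to `0` almost surely.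
  have hcond : ∀ᵐ ω ∂μ, Tendsto (fun m => (μ[Z m | mlim]) ω) atTop (𝓝 ((0 : Ω → ℝ) ω)) := by
    refine tendsto_of_integral_tendsto_of_antitone (fun m => integrable_condExp)
      (integrable_zero _ _ _) ?_ ?_ ?_
    · simpa [integral_condExp hm_le] using hint0
    · have : ∀ m, μ[Z (m + 1) | mlim] ≤ᵐ[μ] μ[Z m | mlim] := fun m =>
        condExp_mono (hZint _) (hZint _) (by
          filter_upwards [hanti] with ω h using h (Nat.le_succ m))
      filter_upwards [ae_all_iff.2 this] with ω h
      exact antitone_nat_of_succ_le h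
    · refine ae_all_iff.2 fun m => ?_
      exact condExp_nonneg (Eventually.of_forall (hZ0 m))
  have hdom : ∀ᵐ ω ∂μ, ∀ m n, m ≤ n → |(μ[v n | 𝒢 n]) ω| ≤ (μ[Z m | 𝒢 n]) ω := by
    refine ae_all_iff.2 fun m => ae_all_iff.2 fun n => ?_
    by_cases hmn : m ≤ n
    · have hvn : Integrable (v n) μ := by
        refine hY.mono' (hv n).aestronglyMeasurable ?_
        filter_upwards [hle] with ω h using h n
      have h2 : μ[(|v n|) | 𝒢 n] ≤ᵐ[μ] μ[Z m | 𝒢 n] :=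
        condExp_mono hvn.abs (hZint m) (by
          filter_upwards [hvZ] with ω h using h m n hmn)
      filter_upwards [abs_condExp_ae_le_condExp_abs (m := 𝒢 n) (μ := μ) (v n), h2] with ω h1 h2 _
      exact h1.trans h2
    · exact Eventually.of_forall fun _ h => absurd h hmn
  have hlevy : ∀ᵐ ω ∂μ, ∀ m, Tendsto (fun n => (μ[Z m | 𝒢 n]) ω) atTop
      (𝓝 ((μ[Z m | mlim]) ω)) := ae_all_iff.2 fun m => tendsto_ae_condExp (Z m)
  filter_upwards [hcond, hdom, hlevy] with ω h1 h2 h3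
  rw [Metric.tendsto_atTop']
  intro ε hε
  obtain ⟨m, hmε⟩ := (h1.eventually_lt_const hε).exists
  obtain ⟨n₀, hn₀⟩ := eventually_atTop.1 ((h3 m).eventually_lt_const hmε)
  refine ⟨max m n₀, fun n hn => ?_⟩
  rw [Real.dist_eq, sub_zero]
  exact (h2 m n ((le_max_left _ _).trans hn.le)).trans_lt (hn₀ n ((le_max_right _ _).trans hn.le))

/-- A martingale difference is orthogonal to bounded random variables of the past. -/
lemma integral_mul_eq_zero_of_condExp {Ω : Type*} {m mΩ : MeasurableSpace Ω} {μ : Measure Ω}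
    [IsFiniteMeasure μ] (hm : m ≤ mΩ) {u d : Ω → ℝ} {c : ℝ} (hu : Measurable[m] u)
    (huc : ∀ ω, |u ω| ≤ c) (hd : Integrable d μ) (hd0 : μ[d | m] =ᵐ[μ] 0) :
    ∫ ω, u ω * d ω ∂μ = 0 := by
  have h1 := condExp_stronglyMeasurable_mul_of_bound hm (μ := μ) hu.stronglyMeasurable hd c
    (Eventually.of_forall huc)
  have h2 : ∫ ω, (μ[u * d | m]) ω ∂μ = ∫ ω, u ω * d ω ∂μ := integral_condExp hm
  rw [← h2]
  refine (integral_congr_ae ?_).trans (integral_zero Ω ℝ)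
  filter_upwards [h1, hd0] with ω h3 h4
  rw [h3, Pi.mul_apply, h4, Pi.zero_apply, mul_zero]

/-! ### Square integrable martingales with bounded increments -/

section BoundedDifferences

variable {Ω : Type*} {mΩ : MeasurableSpace Ω} {μ : Measure Ω} [IsProbabilityMeasure μ]
  {ℱ : Filtration ℕ mΩ} {e : ℕ → Ω → ℝ}

lemma integrable_of_abs_le {f : Ω → ℝ} (hf : Measurable f) (hb : ∃ c, ∀ ω, |f ω| ≤ c) :
    Integrable f μ := by
  obtain ⟨c, hc⟩ := hb
  exact Integrable.of_bound hf.aestronglyMeasurable c (Eventually.of_forall hc)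

lemma exists_abs_mul_le {f g : Ω → ℝ} (hf : ∃ c, ∀ ω, |f ω| ≤ c) (hg : ∃ c, ∀ ω, |g ω| ≤ c) :
    ∃ c, ∀ ω, |f ω * g ω| ≤ c := by
  obtain ⟨c, hc⟩ := hf
  obtain ⟨c', hc'⟩ := hg
  exact ⟨c * c', fun ω => by
    rw [abs_mul]
    exact mul_le_mul (hc ω) (hc' ω) (abs_nonneg _) ((abs_nonneg _).trans (hc ω))⟩

lemma exists_abs_sum_le (he : ∀ k, ∃ c, ∀ ω, |e k ω| ≤ c) (n : ℕ) :
    ∃ c, ∀ ω, |∑ k ∈ Finset.range n, e k ω| ≤ c := by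
  choose c hc using he
  exact ⟨∑ k ∈ Finset.range n, c k, fun ω =>
    (Finset.abs_sum_le_sum_abs _ _).trans (Finset.sum_le_sum fun k _ => hc k ω)⟩

lemma exists_abs_partialSups_le {s : ℕ → Ω → ℝ} (hs : ∀ k, ∃ c, ∀ ω, |s k ω| ≤ c) (n : ℕ) :
    ∃ c, ∀ ω, |partialSups (fun k => s k ω) n| ≤ c := by
  induction n with
  | zero => simpa using hs 0
  | succ n ih =>
    obtain ⟨c, hc⟩ := ih
    obtain ⟨c', hc'⟩ := hs (n + 1)
    refine ⟨max c c', fun ω => ?_⟩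
    rw [partialSups_add_one]
    exact abs_max_le_max_abs_abs.trans (max_le_max (hc ω) (hc' ω))

lemma measurable_partialSups {m : ℕ → MeasurableSpace Ω} (hm : Monotone m) {s : ℕ → Ω → ℝ}
    (hs : ∀ k, Measurable[m k] (s k)) (n : ℕ) :
    Measurable[m n] (fun ω => partialSups (fun k => s k ω) n) := by
  induction n with
  | zero => simpa using hs 0
  | succ n ih =>
    simp only [partialSups_add_one]
    exact (ih.mono (hm n.le_succ) le_rfl).sup (hs (n + 1))

lemma measurable_sum_range_adapted (he : ∀ k, Measurable[ℱ (k + 1)] (e k)) (n : ℕ) :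
    Measurable[ℱ n] (fun ω => ∑ k ∈ Finset.range n, e k ω) :=
  Finset.measurable_fun_sum _ fun k hk =>
    (he k).mono (ℱ.mono (by have := Finset.mem_range.1 hk; omega)) le_rfl

/-- Pythagoras: each increment is orthogonal to the preceding partial sum, which is bounded and
determined by the past. -/
lemma integral_sq_sum_range (he : ∀ k, Measurable[ℱ (k + 1)] (e k))
    (hb : ∀ k, ∃ c, ∀ ω, |e k ω| ≤ c) (h0 : ∀ k, μ[e k | ℱ k] =ᵐ[μ] 0) (n : ℕ) :
    ∫ ω, (∑ k ∈ Finset.range n, e k ω) ^ 2 ∂μ = ∑ k ∈ Finset.range n, ∫ ω, e k ω ^ 2 ∂μ := by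
  have hem : ∀ k, Measurable (e k) := fun k => (he k).mono (ℱ.le _) le_rfl
  have hsm : ∀ n, Measurable (fun ω => ∑ k ∈ Finset.range n, e k ω) := fun n =>
    (measurable_sum_range_adapted he n).mono (ℱ.le _) le_rfl
  induction n with
  | zero => simp
  | succ n ih =>
    rw [Finset.sum_range_succ, ← ih]
    obtain ⟨c, hc⟩ := exists_abs_sum_le hb n
    have horth := integral_mul_eq_zero_of_condExp (ℱ.le n) (measurable_sum_range_adapted he n) hc
      (integrable_of_abs_le (μ := μ) (hem n) (hb n)) (h0 n)
    have hi1 : Integrable (fun ω => (∑ k ∈ Finset.range n, e k ω) ^ 2) μ := by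
      simp only [pow_two]
      exact integrable_of_abs_le ((hsm n).mul (hsm n)) (exists_abs_mul_le ⟨c, hc⟩ ⟨c, hc⟩)
    have hi2 : Integrable (fun ω => e n ω ^ 2) μ := by
      simp only [pow_two]
      exact integrable_of_abs_le ((hem n).mul (hem n)) (exists_abs_mul_le (hb n) (hb n))
    have hi3 : Integrable (fun ω => (∑ k ∈ Finset.range n, e k ω) * e n ω) μ :=
      integrable_of_abs_le ((hsm n).mul (hem n)) (exists_abs_mul_le ⟨c, hc⟩ (hb n))
    have e1 : ∀ ω, (∑ k ∈ Finset.range (n + 1), e k ω) ^ 2 =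
        (∑ k ∈ Finset.range n, e k ω) ^ 2 + 2 * ((∑ k ∈ Finset.range n, e k ω) * e n ω)
          + e n ω ^ 2 := fun ω => by rw [Finset.sum_range_succ]; ring
    simp only [e1]
    have hi12 : Integrable (fun ω => (∑ k ∈ Finset.range n, e k ω) ^ 2
        + 2 * ((∑ k ∈ Finset.range n, e k ω) * e n ω)) μ := hi1.add (hi3.const_mul 2)
    rw [integral_add hi12 hi2, integral_add hi1 (hi3.const_mul 2),
      integral_const_mul, horth]
    ring

/-- **Doob's maximal inequality** in `L²`. -/
lemma integral_sq_partialSups_le (he : ∀ k, Measurable[ℱ (k + 1)] (e k))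
    (hb : ∀ k, ∃ c, ∀ ω, |e k ω| ≤ c) (h0 : ∀ k, μ[e k | ℱ k] =ᵐ[μ] 0) (n : ℕ) :
    ∫ ω, (partialSups (fun j => ∑ k ∈ Finset.range j, e k ω) n) ^ 2 ∂μ
      ≤ 4 * ∑ k ∈ Finset.range n, ∫ ω, e k ω ^ 2 ∂μ := by
  have hem : ∀ k, Measurable (e k) := fun k => (he k).mono (ℱ.le _) le_rfl
  have hsm : ∀ n, Measurable (fun ω => ∑ k ∈ Finset.range n, e k ω) := fun n =>
    (measurable_sum_range_adapted he n).mono (ℱ.le _) le_rfl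
  have hpm : ∀ j, Measurable[ℱ j]
      (fun ω => partialSups (fun j => ∑ k ∈ Finset.range j, e k ω) j) :=
    measurable_partialSups (fun _ _ h => ℱ.mono h) (measurable_sum_range_adapted he)
  have hpb := exists_abs_partialSups_le (s := fun j ω => ∑ k ∈ Finset.range j, e k ω)
    (exists_abs_sum_le hb)
  set P : ℕ → Ω → ℝ := fun j ω => partialSups (fun j => ∑ k ∈ Finset.range j, e k ω) j with hP
  have hpm' : ∀ j, Measurable (P j) := fun j => (hpm j).mono (ℱ.le _) le_rfl
  rw [← integral_sq_sum_range he hb h0 n]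
  have hi1 : Integrable (fun ω => (∑ k ∈ Finset.range n, e k ω) ^ 2) μ := by
    simp only [pow_two]
    exact integrable_of_abs_le ((hsm n).mul (hsm n))
      (exists_abs_mul_le (exists_abs_sum_le hb n) (exists_abs_sum_le hb n))
  have hi2 : Integrable (fun ω => P n ω ^ 2) μ := by
    simp only [pow_two]
    exact integrable_of_abs_le ((hpm' n).mul (hpm' n)) (exists_abs_mul_le (hpb n) (hpb n))
  have hi3 : ∀ k, Integrable (fun ω => P k ω * e k ω) μ := fun k =>
    integrable_of_abs_le ((hpm' k).mul (hem k)) (exists_abs_mul_le (hpb k) (hb k))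
  have horth : ∀ k, ∫ ω, P k ω * e k ω ∂μ = 0 := fun k => by
    obtain ⟨c, hc⟩ := hpb k
    exact integral_mul_eq_zero_of_condExp (ℱ.le k) (hpm k) hc
      (integrable_of_abs_le (hem k) (hb k)) (h0 k)
  -- The sum is a martingale transform of the running maximum and has mean zero, so integrating the
  -- pathwise inequality gives the constant `4`.
  have hpath : ∀ ω, 1 / 4 * P n ω ^ 2 + ∑ k ∈ Finset.range n, P k ω * e k ω
      ≤ (∑ k ∈ Finset.range n, e k ω) ^ 2 := fun ω => by
    have := sq_partialSups_le (fun j => ∑ k ∈ Finset.range j, e k ω) (by simp) n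
    simpa only [Finset.sum_range_succ, add_sub_cancel_left] using this
  have hint := integral_mono (μ := μ)
    ((hi2.const_mul (1 / 4)).add (integrable_finsetSum (Finset.range n) fun k _ => hi3 k)) hi1 hpath
  simp only [Pi.add_apply] at hint
  rw [integral_add (hi2.const_mul (1 / 4)) (integrable_finsetSum _ fun k _ => hi3 k),
    integral_const_mul, integral_finsetSum _ fun k _ => hi3 k,
    Finset.sum_eq_zero fun k _ => horth k] at hint
  linarith

/-- An `L²`-bounded martingale converges almost surely. -/
lemma ae_tendsto_sum_range (he : ∀ k, Measurable[ℱ (k + 1)] (e k))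
    (hb : ∀ k, ∃ c, ∀ ω, |e k ω| ≤ c) (h0 : ∀ k, μ[e k | ℱ k] =ᵐ[μ] 0) {B : ℝ}
    (hB : ∀ n, ∑ k ∈ Finset.range n, ∫ ω, e k ω ^ 2 ∂μ ≤ B) :
    ∀ᵐ ω ∂μ, ∃ l, Tendsto (fun n => ∑ k ∈ Finset.range n, e k ω) atTop (𝓝 l) := by
  have hsm := measurable_sum_range_adapted he
  have hint : ∀ n, Integrable (fun ω => ∑ k ∈ Finset.range n, e k ω) μ := fun n =>
    integrable_of_abs_le ((hsm n).mono (ℱ.le _) le_rfl) (exists_abs_sum_le hb n)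
  have hmart : Martingale (fun n ω => ∑ k ∈ Finset.range n, e k ω) ℱ μ := by
    refine martingale_of_condExp_sub_eq_zero_nat (fun n => (hsm n).stronglyMeasurable) hint
      fun i => ?_
    refine Filter.EventuallyEq.trans (Eventually.of_forall fun ω => ?_) (h0 i)
    congr 1
    ext ω
    simp [Finset.sum_range_succ]
  refine hmart.submartingale.exists_ae_tendsto_of_bdd (R := (1 + B).toNNReal) fun n => ?_
  rw [eLpNorm_one_eq_lintegral_enorm, ← ofReal_integral_norm_eq_lintegral_enorm (hint n)]
  refine ENNReal.ofReal_le_ofReal ?_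
  have hi1 : Integrable (fun ω => (∑ k ∈ Finset.range n, e k ω) ^ 2) μ := by
    simp only [pow_two]
    exact integrable_of_abs_le
      (((hsm n).mono (ℱ.le _) le_rfl).mul ((hsm n).mono (ℱ.le _) le_rfl))
      (exists_abs_mul_le (exists_abs_sum_le hb n) (exists_abs_sum_le hb n))
  -- The `L¹` bound needed for convergence follows from the `L²` bound through `|s| ≤ 1 + s ^ 2`.
  have hle := integral_mono (μ := μ) (hint n).norm ((integrable_const (1 : ℝ)).add hi1) fun ω => by
    simp only [Pi.add_apply, Real.norm_eq_abs]
    nlinarith [sq_abs (∑ k ∈ Finset.range n, e k ω), abs_nonneg (∑ k ∈ Finset.range n, e k ω),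
      sq_nonneg (|∑ k ∈ Finset.range n, e k ω| - 1)]
  simp only [Pi.add_apply] at hle
  rw [integral_add (integrable_const _) hi1, integral_sq_sum_range he hb h0] at hle
  simp only [integral_const, probReal_univ, one_smul] at hle
  exact hle.trans (by linarith [hB n])

end BoundedDifferences

/-! ### Stochastic approximation with contracted targets -/

/-- A stochastic approximation scheme `x (n + 1) = (1 - a n) * x n + a n * f n + d n` with finitely
many coordinates, whose targets `f` grow at most like `C + κ * ‖x‖` and whose martingale
differences `d` are at most `a * (K * (1 + ‖x‖))`. -/
structure IsRelaxationScheme {Ω ι : Type*} [Fintype ι] {mΩ : MeasurableSpace Ω} (μ : Measure Ω)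
    (ℱ : Filtration ℕ mΩ) (x a f d : ℕ → Ω → ι → ℝ) (κ C K : ℝ) : Prop where
  step_mem : ∀ n ω i, 0 ≤ a n ω i ∧ a n ω i ≤ 1
  step_eq : ∀ n ω i, x (n + 1) ω i
    = (1 - a n ω i) * x n ω i + a n ω i * f n ω i + d n ω i
  target_le : ∀ n ω i, |f n ω i| ≤ C + κ * ‖x n ω‖
  noise_le : ∀ n ω i, |d n ω i| ≤ a n ω i * (K * (1 + ‖x n ω‖))
  measurable_value : ∀ n i, Measurable[ℱ n] fun ω => x n ω i
  measurable_noise : ∀ n i, Measurable[ℱ (n + 1)] fun ω => d n ω i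
  condExp_noise : ∀ n i, μ[fun ω => d n ω i | ℱ n] =ᵐ[μ] 0
  bounded : ∀ n, ∃ R, ∀ ω, ‖x n ω‖ ≤ R

namespace IsRelaxationScheme

variable {Ω ι : Type*} [Fintype ι] {mΩ : MeasurableSpace Ω} {μ : Measure Ω}
  {ℱ : Filtration ℕ mΩ} {x a f d : ℕ → Ω → ι → ℝ} {κ C K : ℝ}

lemma noise_bounded (h : IsRelaxationScheme μ ℱ x a f d κ C K) (hK : 0 ≤ K) (n : ℕ) (i : ι) :
    ∃ c, ∀ ω, |d n ω i| ≤ c := by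
  obtain ⟨R, hR⟩ := h.bounded n
  refine ⟨K * (1 + R), fun ω => (h.noise_le n ω i).trans ?_⟩
  have h0 := norm_nonneg (x n ω)
  calc a n ω i * (K * (1 + ‖x n ω‖)) ≤ 1 * (K * (1 + ‖x n ω‖)) :=
        mul_le_mul_of_nonneg_right (h.step_mem n ω i).2 (by positivity)
    _ ≤ K * (1 + R) := by rw [one_mul]; gcongr; exact hR ω

/-- The running maximum of the scheme. -/
noncomputable def runningMax (x : ℕ → Ω → ι → ℝ) (n : ℕ) (ω : Ω) : ℝ :=
  partialSups (fun k => ‖x k ω‖) n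

lemma norm_le_runningMax {k n : ℕ} (hkn : k ≤ n) (ω : Ω) : ‖x k ω‖ ≤ runningMax x n ω :=
  le_partialSups_of_le (fun k => ‖x k ω‖) hkn

lemma runningMax_nonneg (n : ℕ) (ω : Ω) : 0 ≤ runningMax x n ω :=
  (norm_nonneg _).trans (norm_le_runningMax le_rfl ω)

lemma measurable_norm_value (h : IsRelaxationScheme μ ℱ x a f d κ C K) (n : ℕ) :
    Measurable fun ω => ‖x n ω‖ :=
  (measurable_pi_iff.2 fun i => (h.measurable_value n i).mono (ℱ.le n) le_rfl).norm

lemma measurable_runningMax (h : IsRelaxationScheme μ ℱ x a f d κ C K) (n : ℕ) :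
    Measurable (runningMax x n) :=
  measurable_partialSups (m := fun _ => mΩ) monotone_const h.measurable_norm_value n

lemma bounded_runningMax (h : IsRelaxationScheme μ ℱ x a f d κ C K) (n : ℕ) :
    ∃ c, ∀ ω, |runningMax x n ω| ≤ c :=
  exists_abs_partialSups_le (s := fun k ω => ‖x k ω‖) (fun k => by simpa using h.bounded k) n

/-- The maximum of the scheme is controlled by the maxima of its accumulated noise. -/
lemma one_add_runningMax_le (h : IsRelaxationScheme μ ℱ x a f d κ C K) (hκ0 : 0 ≤ κ) (hC : 0 ≤ C)
    {N : ℕ} {R : ℝ} (hR : ∀ k ≤ N, ∀ ω, ‖x k ω‖ ≤ R) {T : ℕ} {ω : Ω} {δ : ℝ}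
    (hδ : ∀ k ≤ T, ∀ i, |∑ j ∈ Finset.range k, if N ≤ j then d j ω i else 0| ≤ δ) (hδ0 : 0 ≤ δ) :
    (1 - κ) * (1 + runningMax x T ω) ≤ 1 + R + C + 2 * δ := by
  have hR0 : 0 ≤ R := (norm_nonneg _).trans (hR 0 (Nat.zero_le _) ω)
  have hZ := runningMax_nonneg (x := x) T ω
  -- The running maximum also bounds the targets, so the relaxation estimate is circular; `κ < 1`
  -- will make it informative once the `κ` term is moved to the left.
  have key : runningMax x T ω ≤ R + C + κ * runningMax x T ω + 2 * δ := by
    refine partialSups_le _ _ _ fun n hn => ?_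
    have hκZ : 0 ≤ κ * runningMax x T ω := by positivity
    rcases le_total n N with hnN | hnN
    · have := hR n hnN ω
      linarith
    · refine (pi_norm_le_iff_of_nonneg (by linarith)).2 fun i => ?_
      refine abs_le_of_relaxation (N := N) (T := T) (x := fun k => x k ω i)
        (a := fun k => a k ω i) (f := fun k => f k ω i) (d := fun k => d k ω i)
        (m := fun k => ∑ j ∈ Finset.range k, if N ≤ j then d j ω i else 0)
        (fun k => h.step_mem k ω i) (fun k _ => h.step_eq k ω i) (fun k hk => ?_) ?_
        (fun k _ hk => ?_) ?_ (fun k _ hk => hδ k hk i) n hnN hn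
      · rw [Finset.sum_range_succ, if_pos hk]
      · exact Finset.sum_eq_zero fun j hj => if_neg (by simpa using hj)
      · have h1 := h.target_le k ω i
        have h2 := mul_le_mul_of_nonneg_left (norm_le_runningMax (x := x) hk.le ω) hκ0
        linarith
      · have h1 := hR N le_rfl ω
        have h2 := (norm_le_pi_norm (x N ω) i).trans h1
        rw [Real.norm_eq_abs] at h2
        linarith
  nlinarith

/-- The noise that enters the scheme from time `N` on. -/
noncomputable def lateNoise (N : ℕ) (d : ℕ → Ω → ι → ℝ) (i : ι) (k : ℕ) (ω : Ω) : ℝ :=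
  if N ≤ k then d k ω i else 0

lemma measurable_lateNoise (h : IsRelaxationScheme μ ℱ x a f d κ C K) (N : ℕ) (i : ι) (k : ℕ) :
    Measurable[ℱ (k + 1)] (lateNoise N d i k) := by
  by_cases hk : N ≤ k
  · have : lateNoise N d i k = fun ω => d k ω i := by ext ω; simp [lateNoise, hk]
    rw [this]; exact h.measurable_noise k i
  · have : lateNoise N d i k = 0 := by ext ω; simp [lateNoise, hk]
    rw [this]; exact measurable_const

lemma bounded_lateNoise (h : IsRelaxationScheme μ ℱ x a f d κ C K) (hK : 0 ≤ K) (N : ℕ) (i : ι)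
    (k : ℕ) : ∃ c, ∀ ω, |lateNoise N d i k ω| ≤ c := by
  by_cases hk : N ≤ k
  · simpa [lateNoise, hk] using h.noise_bounded hK k i
  · exact ⟨0, fun ω => by simp [lateNoise, hk]⟩

lemma condExp_lateNoise (h : IsRelaxationScheme μ ℱ x a f d κ C K) (N : ℕ) (i : ι) (k : ℕ) :
    μ[lateNoise N d i k | ℱ k] =ᵐ[μ] 0 := by
  by_cases hk : N ≤ k
  · have : lateNoise N d i k = fun ω => d k ω i := by ext ω; simp [lateNoise, hk]
    rw [this]; exact h.condExp_noise k i
  · have : lateNoise N d i k = 0 := by ext ω; simp [lateNoise, hk]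
    rw [this, condExp_zero]

variable [IsProbabilityMeasure μ]

lemma integrable_sq {f : Ω → ℝ} (hf : Measurable f) (hb : ∃ c, ∀ ω, |f ω| ≤ c) :
    Integrable (fun ω => f ω ^ 2) μ := by
  simp only [pow_two]
  exact integrable_of_abs_le (hf.mul hf) (exists_abs_mul_le hb hb)

lemma integrable_sq_one_add_runningMax (h : IsRelaxationScheme μ ℱ x a f d κ C K) (T : ℕ) :
    Integrable (fun ω => (1 + runningMax x T ω) ^ 2) μ := by
  refine integrable_sq (measurable_const.add (h.measurable_runningMax T)) ?_
  obtain ⟨c, hc⟩ := h.bounded_runningMax T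
  exact ⟨1 + c, fun ω => (abs_add_le _ _).trans (by rw [abs_one]; linarith [hc ω])⟩

/-- The total variance of the noise after time `N`. -/
lemma sum_integral_sq_lateNoise_le (h : IsRelaxationScheme μ ℱ x a f d κ C K) (hK : 0 ≤ K)
    {N : ℕ} {ε : ℝ} (hε : ∀ T ω, ∑ k ∈ Finset.Ico N T, ∑ i, a k ω i ^ 2 ≤ ε) (T : ℕ) :
    ∑ i, ∑ k ∈ Finset.range T, ∫ ω, lateNoise N d i k ω ^ 2 ∂μ
      ≤ K ^ 2 * ε * ∫ ω, (1 + runningMax x T ω) ^ 2 ∂μ := by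
  have hi : ∀ i k, Integrable (fun ω => lateNoise N d i k ω ^ 2) μ := fun i k =>
    integrable_sq ((h.measurable_lateNoise N i k).mono (ℱ.le _) le_rfl)
      (h.bounded_lateNoise hK N i k)
  simp only [← integral_finsetSum _ fun k _ => hi _ k]
  rw [← integral_finsetSum _ fun i _ => integrable_finsetSum _ fun k _ => hi i k,
    ← integral_const_mul]
  refine integral_mono (integrable_finsetSum _ fun i _ => integrable_finsetSum _ fun k _ => hi i k)
    ((h.integrable_sq_one_add_runningMax T).const_mul _) fun ω => ?_
  dsimp only
  have hterm : ∀ i, ∀ k ∈ Finset.range T, lateNoise N d i k ω ^ 2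
      ≤ (if N ≤ k then a k ω i ^ 2 else 0) * (K ^ 2 * (1 + runningMax x T ω) ^ 2) := by
    intro i k hk
    by_cases hNk : N ≤ k
    · simp only [lateNoise, hNk, if_true]
      have h1 := h.noise_le k ω i
      have h2 := norm_le_runningMax (x := x) (Finset.mem_range.1 hk).le ω
      have h3 := (h.step_mem k ω i).1
      have h4 : |d k ω i| ≤ a k ω i * (K * (1 + runningMax x T ω)) := by
        refine h1.trans ?_
        gcongr
      calc d k ω i ^ 2 = |d k ω i| ^ 2 := (sq_abs _).symm
        _ ≤ (a k ω i * (K * (1 + runningMax x T ω))) ^ 2 := by gcongr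
        _ = _ := by ring
    · simp [lateNoise, hNk]
  calc ∑ i, ∑ k ∈ Finset.range T, lateNoise N d i k ω ^ 2
      ≤ ∑ i, ∑ k ∈ Finset.range T,
        (if N ≤ k then a k ω i ^ 2 else 0) * (K ^ 2 * (1 + runningMax x T ω) ^ 2) :=
        Finset.sum_le_sum fun i _ => Finset.sum_le_sum (hterm i)
    _ = (∑ k ∈ Finset.Ico N T, ∑ i, a k ω i ^ 2) * (K ^ 2 * (1 + runningMax x T ω) ^ 2) := by
        simp only [← Finset.sum_mul]
        congr 1
        rw [Finset.sum_comm, Finset.sum_comm (s := Finset.Ico N T), Finset.sum_comm]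
        refine Finset.sum_congr rfl fun i _ => ?_
        rw [← Finset.sum_filter]
        refine Finset.sum_congr ?_ fun _ _ => rfl
        ext k
        simp only [Finset.mem_filter, Finset.mem_range, Finset.mem_Ico]
        exact and_comm
    _ ≤ ε * (K ^ 2 * (1 + runningMax x T ω) ^ 2) := by
        gcongr
        exact hε T ω
    _ = _ := by ring

/-- If the squared step sizes after time `N` have a small sum, then the running maxima are bounded
in `L²`. -/
lemma integral_sq_runningMax_le (h : IsRelaxationScheme μ ℱ x a f d κ C K) (hκ0 : 0 ≤ κ)
    (hκ1 : κ < 1) (hC : 0 ≤ C) (hK : 0 ≤ K)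
    {N : ℕ} {ε : ℝ} (hε : ∀ T ω, ∑ k ∈ Finset.Ico N T, ∑ i, a k ω i ^ 2 ≤ ε)
    (hsmall : 256 * Fintype.card ι * K ^ 2 * ε ≤ (1 - κ) ^ 2)
    {R : ℝ} (hR : ∀ k ≤ N, ∀ ω, ‖x k ω‖ ≤ R) (T : ℕ) :
    ∫ ω, (1 + runningMax x T ω) ^ 2 ∂μ ≤ 4 * (1 + R + C) ^ 2 / (1 - κ) ^ 2 := by
  set P : ι → Ω → ℝ := fun i ω =>
    partialSups (fun j => ∑ k ∈ Finset.range j, lateNoise N d i k ω) T with hP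
  -- The maximal inequality is one-sided, so the negated noise is needed to control the accumulated
  -- noise from below.
  set Q : ι → Ω → ℝ := fun i ω =>
    partialSups (fun j => ∑ k ∈ Finset.range j, -lateNoise N d i k ω) T with hQ
  have hme := h.measurable_lateNoise N
  have hbe := h.bounded_lateNoise hK N
  have h0e := h.condExp_lateNoise N
  have hme' : ∀ i k, Measurable[ℱ (k + 1)] (fun ω => -lateNoise N d i k ω) :=
    fun i k => (hme i k).neg
  have hbe' : ∀ i k, ∃ c, ∀ ω, |-lateNoise N d i k ω| ≤ c := by simpa using hbe
  have h0e' : ∀ i k, μ[fun ω => -lateNoise N d i k ω | ℱ k] =ᵐ[μ] 0 := fun i k => by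
    refine (condExp_neg (lateNoise N d i k) (ℱ k)).trans ?_
    filter_upwards [h0e i k] with ω hω
    simp [hω]
  have hPint : ∀ i, Integrable (fun ω => P i ω ^ 2) μ := fun i =>
    integrable_sq (measurable_partialSups (m := fun _ => mΩ) monotone_const (fun j =>
      (measurable_sum_range_adapted (hme i) j).mono (ℱ.le _) le_rfl) T)
      (exists_abs_partialSups_le (exists_abs_sum_le (hbe i)) T)
  have hQint : ∀ i, Integrable (fun ω => Q i ω ^ 2) μ := fun i =>
    integrable_sq (measurable_partialSups (m := fun _ => mΩ) monotone_const (fun j =>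
      (measurable_sum_range_adapted (hme' i) j).mono (ℱ.le _) le_rfl) T)
      (exists_abs_partialSups_le (exists_abs_sum_le (hbe' i)) T)
  have hP2 : ∀ i, ∫ ω, P i ω ^ 2 ∂μ ≤ 4 * ∑ k ∈ Finset.range T, ∫ ω, lateNoise N d i k ω ^ 2 ∂μ :=
    fun i => integral_sq_partialSups_le (hme i) (hbe i) (h0e i) T
  have hQ2 : ∀ i, ∫ ω, Q i ω ^ 2 ∂μ ≤ 4 * ∑ k ∈ Finset.range T, ∫ ω, lateNoise N d i k ω ^ 2 ∂μ :=
    fun i => by simpa only [neg_sq] using integral_sq_partialSups_le (hme' i) (hbe' i) (h0e' i) T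
  have hP0 : ∀ i ω, 0 ≤ P i ω := fun i ω => by
    simpa using le_partialSups_of_le
      (fun j => ∑ k ∈ Finset.range j, lateNoise N d i k ω) (Nat.zero_le T)
  have hQ0 : ∀ i ω, 0 ≤ Q i ω := fun i ω => by
    have := le_partialSups_of_le
      (fun j => ∑ k ∈ Finset.range j, -lateNoise N d i k ω) (Nat.zero_le T)
    simpa only [Finset.range_zero, Finset.sum_empty] using this
  -- The `16` is `2 * 2 ^ 2 * 2`: squaring the sum, the factor `2` before `δ`, and splitting `(P +
  -- Q) ^ 2`. The cardinality comes from Cauchy–Schwarz.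
  have hpath : ∀ ω, (1 - κ) ^ 2 * (1 + runningMax x T ω) ^ 2
      ≤ 2 * (1 + R + C) ^ 2 + 16 * Fintype.card ι * ∑ i, (P i ω ^ 2 + Q i ω ^ 2) := by
    intro ω
    have hR0 : 0 ≤ R := (norm_nonneg _).trans (hR 0 (Nat.zero_le _) ω)
    have hle := h.one_add_runningMax_le hκ0 hC hR (T := T) (ω := ω)
      (δ := ∑ i, (P i ω + Q i ω)) (fun k hk i => ?_)
      (Finset.sum_nonneg fun i _ => add_nonneg (hP0 i ω) (hQ0 i ω))
    · have hZ := runningMax_nonneg (x := x) T ω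
      have hcs : (∑ i, (P i ω + Q i ω)) ^ 2 ≤ Fintype.card ι * ∑ i, (P i ω + Q i ω) ^ 2 :=
        sq_sum_le_card_mul_sum_sq
      have hpq : ∑ i, (P i ω + Q i ω) ^ 2 ≤ 2 * ∑ i, (P i ω ^ 2 + Q i ω ^ 2) := by
        rw [Finset.mul_sum]
        exact Finset.sum_le_sum fun i _ => by nlinarith [sq_nonneg (P i ω - Q i ω)]
      have hpq' := mul_le_mul_of_nonneg_left hpq (Nat.cast_nonneg (α := ℝ) (Fintype.card ι))
      have hsq : ((1 - κ) * (1 + runningMax x T ω)) ^ 2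
          ≤ (1 + R + C + 2 * ∑ i, (P i ω + Q i ω)) ^ 2 :=
        pow_le_pow_left₀ (mul_nonneg (by linarith) (by linarith)) hle 2
      rw [mul_pow] at hsq
      nlinarith [sq_nonneg (1 + R + C - 2 * ∑ i, (P i ω + Q i ω))]
    · have h1 := le_partialSups_of_le
        (fun j => ∑ k ∈ Finset.range j, lateNoise N d i k ω) hk
      have h2 : ∑ k ∈ Finset.range k, -lateNoise N d i k ω ≤ Q i ω := le_partialSups_of_le
        (fun j => ∑ k ∈ Finset.range j, -lateNoise N d i k ω) hk
      have h3 : P i ω + Q i ω ≤ ∑ i, (P i ω + Q i ω) :=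
        Finset.single_le_sum (f := fun i => P i ω + Q i ω)
          (fun i _ => add_nonneg (hP0 i ω) (hQ0 i ω)) (Finset.mem_univ i)
      have h4 := hP0 i ω
      have h5 := hQ0 i ω
      rw [Finset.sum_neg_distrib] at h2
      change |∑ j ∈ Finset.range k, lateNoise N d i j ω| ≤ _
      rw [abs_le]
      constructor <;> linarith
  have hPQint : ∀ i, Integrable (fun ω => P i ω ^ 2 + Q i ω ^ 2) μ := fun i =>
    (hPint i).add (hQint i)
  have hsumint : Integrable (fun ω => ∑ i, (P i ω ^ 2 + Q i ω ^ 2)) μ :=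
    integrable_finsetSum _ fun i _ => hPQint i
  have hint := integral_mono (μ := μ) ((h.integrable_sq_one_add_runningMax T).const_mul _)
    ((integrable_const _).add (hsumint.const_mul (16 * (Fintype.card ι : ℝ)))) hpath
  simp only [Pi.add_apply] at hint
  rw [integral_const_mul, integral_add (integrable_const _) (hsumint.const_mul _),
    integral_const, integral_const_mul, integral_finsetSum _ fun i _ => hPQint i] at hint
  simp only [probReal_univ, one_smul] at hint
  have hvar := h.sum_integral_sq_lateNoise_le hK hε T
  have hPQ : ∑ i, ∫ ω, (P i ω ^ 2 + Q i ω ^ 2) ∂μ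
      ≤ 8 * (K ^ 2 * ε * ∫ ω, (1 + runningMax x T ω) ^ 2 ∂μ) := by
    refine le_trans ?_ (mul_le_mul_of_nonneg_left hvar (by norm_num))
    rw [Finset.mul_sum]
    refine Finset.sum_le_sum fun i _ => ?_
    rw [integral_add (hPint i) (hQint i)]
    linarith [hP2 i, hQ2 i]
  have hE : 0 ≤ ∫ ω, (1 + runningMax x T ω) ^ 2 ∂μ := integral_nonneg fun ω => sq_nonneg _
  -- Doob's `4` for `P` and for `Q` gives `8`, and `16 * 8` is half of `256`: the noise absorbs at
  -- most half of the left side. This is legitimate because the second moment is finite for each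
  -- fixed `T`.
  have h1 := mul_le_mul_of_nonneg_left hPQ
    (show (0 : ℝ) ≤ 16 * Fintype.card ι by positivity)
  have h2 := mul_le_mul_of_nonneg_right hsmall hE
  have hpos : 0 < (1 - κ) ^ 2 := by have : 0 < 1 - κ := by linarith
                                    positivity
  rw [le_div_iff₀ hpos]
  linarith

/-- Under the same assumption the scheme is dominated by an integrable random variable. -/
lemma exists_integrable_bound (h : IsRelaxationScheme μ ℱ x a f d κ C K) (hκ0 : 0 ≤ κ)
    (hκ1 : κ < 1) (hC : 0 ≤ C) (hK : 0 ≤ K)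
    {N : ℕ} {ε : ℝ} (hε : ∀ T ω, ∑ k ∈ Finset.Ico N T, ∑ i, a k ω i ^ 2 ≤ ε)
    (hsmall : 256 * Fintype.card ι * K ^ 2 * ε ≤ (1 - κ) ^ 2) :
    ∃ Y : Ω → ℝ, Integrable Y μ ∧ ∀ᵐ ω ∂μ, ∀ n, ‖x n ω‖ ≤ Y ω := by
  obtain ⟨R, hR⟩ := h.bounded_runningMax N
  have hR' : ∀ k ≤ N, ∀ ω, ‖x k ω‖ ≤ R := fun k hk ω =>
    (norm_le_runningMax hk ω).trans ((le_abs_self _).trans (hR ω))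
  set B : ℝ := 4 * (1 + R + C) ^ 2 / (1 - κ) ^ 2
  have hB : ∀ T, ∫⁻ ω, ENNReal.ofReal (runningMax x T ω) ∂μ ≤ ENNReal.ofReal B := by
    intro T
    have hi : Integrable (runningMax x T) μ :=
      integrable_of_abs_le (h.measurable_runningMax T) (h.bounded_runningMax T)
    rw [← ofReal_integral_eq_lintegral_ofReal hi (Eventually.of_forall (runningMax_nonneg T))]
    refine ENNReal.ofReal_le_ofReal (le_trans ?_
      (h.integral_sq_runningMax_le hκ0 hκ1 hC hK hε hsmall hR' T))
    refine integral_mono hi (h.integrable_sq_one_add_runningMax T) fun ω => ?_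
    have := runningMax_nonneg (x := x) T ω
    dsimp only
    nlinarith
  -- The bound `B` does not depend on `T`, so monotone convergence carries it to the supremum over
  -- all times.
  have hlin : ∫⁻ ω, ⨆ T, ENNReal.ofReal (runningMax x T ω) ∂μ ≤ ENNReal.ofReal B := by
    rw [lintegral_iSup (fun T => (h.measurable_runningMax T).ennreal_ofReal)
      (fun m n hmn ω => ENNReal.ofReal_le_ofReal
        ((partialSups (fun k => ‖x k ω‖)).monotone hmn))]
    exact iSup_le hB
  have hmeas : Measurable fun ω => ⨆ T, ENNReal.ofReal (runningMax x T ω) :=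
    Measurable.iSup fun T => (h.measurable_runningMax T).ennreal_ofReal
  have hne : ∫⁻ ω, ⨆ T, ENNReal.ofReal (runningMax x T ω) ∂μ ≠ ⊤ :=
    (hlin.trans_lt ENNReal.ofReal_lt_top).ne
  refine ⟨fun ω => (⨆ T, ENNReal.ofReal (runningMax x T ω)).toReal,
    integrable_toReal_of_lintegral_ne_top hmeas.aemeasurable hne, ?_⟩
  filter_upwards [ae_lt_top hmeas hne] with ω hω n
  refine (norm_le_runningMax le_rfl ω).trans ?_
  refine (ENNReal.ofReal_le_iff_le_toReal hω.ne).1 ?_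
  exact le_iSup (fun T => ENNReal.ofReal (runningMax x T ω)) n

/-- Under the same assumption the accumulated noise converges almost surely. -/
lemma ae_tendsto_noise (h : IsRelaxationScheme μ ℱ x a f d κ C K) (hκ0 : 0 ≤ κ)
    (hκ1 : κ < 1) (hC : 0 ≤ C) (hK : 0 ≤ K)
    {N : ℕ} {ε : ℝ} (hε : ∀ T ω, ∑ k ∈ Finset.Ico N T, ∑ i, a k ω i ^ 2 ≤ ε)
    (hsmall : 256 * Fintype.card ι * K ^ 2 * ε ≤ (1 - κ) ^ 2) :
    ∀ᵐ ω ∂μ, ∀ i, ∃ l, Tendsto (fun n => ∑ k ∈ Finset.range n, d k ω i) atTop (𝓝 l) := by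
  obtain ⟨R, hR⟩ := h.bounded_runningMax N
  have hR' : ∀ k ≤ N, ∀ ω, ‖x k ω‖ ≤ R := fun k hk ω =>
    (norm_le_runningMax hk ω).trans ((le_abs_self _).trans (hR ω))
  obtain ⟨ω₀⟩ : Nonempty Ω := μ.nonempty_of_neZero
  have hε0 : 0 ≤ ε := by simpa using hε 0 ω₀
  refine ae_all_iff.2 fun i => ?_
  have hconv := ae_tendsto_sum_range (h.measurable_lateNoise N i) (h.bounded_lateNoise hK N i)
    (h.condExp_lateNoise N i) (B := K ^ 2 * ε * (4 * (1 + R + C) ^ 2 / (1 - κ) ^ 2)) fun n => by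
      refine le_trans ?_ ((h.sum_integral_sq_lateNoise_le hK hε n).trans
        (mul_le_mul_of_nonneg_left
          (h.integral_sq_runningMax_le hκ0 hκ1 hC hK hε hsmall hR' n) (by positivity)))
      exact Finset.single_le_sum
        (f := fun i => ∑ k ∈ Finset.range n, ∫ ω, lateNoise N d i k ω ^ 2 ∂μ)
        (fun i _ => Finset.sum_nonneg fun k _ => integral_nonneg fun ω => sq_nonneg _)
        (Finset.mem_univ i)
  filter_upwards [hconv] with ω ⟨l, hl⟩
  refine ⟨l + ∑ k ∈ Finset.range N, d k ω i, ?_⟩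
  refine (hl.add_const (∑ k ∈ Finset.range N, d k ω i)).congr' ?_
  filter_upwards [eventually_ge_atTop N] with n hn
  rw [← Finset.sum_range_add_sum_Ico _ hn, ← Finset.sum_range_add_sum_Ico (fun k => d k ω i) hn,
    Finset.sum_eq_zero (s := Finset.range N), zero_add, add_comm]
  · congr 1
    exact Finset.sum_congr rfl fun k hk => if_pos (Finset.mem_Ico.1 hk).1
  · exact fun k hk => if_neg (by simpa using hk)

end IsRelaxationScheme

/-! ### Double SOR Q-learning as a relaxation scheme -/

section Tables

variable {S A : Type*}

/-- The two tables as a single vector; the table `A` carries the index `true`. -/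
def flatten (Q : TablePair S A) (z : Bool × S × A) : ℝ :=
  if z.1 = true then Q.1 z.2.1 z.2.2 else Q.2 z.2.1 z.2.2

/-- The value of the greedy action in the state `j` used when the table `b` is updated. -/
def greedyValue (g : (A → ℝ) → A) (selB : Bool) (x : Bool × S × A → ℝ) (b : Bool) (j : S) : ℝ :=
  x (!b, j, g fun u => x (b || !selB, j, u))

variable [Fintype S]

/-- The target of the update of the entry `(s, u)` of the table `b` on a transition to `j`. -/
def updateTarget (M : FiniteMDP S A) (w : ℝ) (g : (A → ℝ) → A) (selB : Bool)
    (x : Bool × S × A → ℝ) (z : Bool × S × A) (j : S) : ℝ :=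
  w * (M.r z.2.1 z.2.2 j + M.γ * greedyValue g selB x z.1 j)
    + (1 - w) * greedyValue g selB x z.1 z.2.1

/-- The expected target of an update. -/
def meanTarget (M : FiniteMDP S A) (w : ℝ) (g : (A → ℝ) → A) (selB : Bool)
    (x : Bool × S × A → ℝ) (z : Bool × S × A) : ℝ :=
  ∑ j, M.p z.2.1 z.2.2 j * updateTarget M w g selB x z j

/-- Both coin outcomes and both variants become one entrywise formula, so that later estimates
rarely split on `selB`. -/
lemma flatten_dsorStep [DecidableEq S] [DecidableEq A] (M : FiniteMDP S A) (w : ℝ)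
    (g : (A → ℝ) → A) (selB : Bool) (Q : TablePair S A) (i : S) (a : A) (j : S) (β : ℝ)
    (coin : Bool) (z : Bool × S × A) :
    flatten (dsorStep M w g selB Q i a j β coin) z = flatten Q z +
      (if i = z.2.1 ∧ a = z.2.2 then β else 0) * (if coin = z.1 then
        updateTarget M w g selB (flatten Q) z j - flatten Q z else 0) := by
  obtain ⟨b, s, u⟩ := z
  by_cases hsu : i = s ∧ a = u
  · obtain ⟨rfl, rfl⟩ := hsu
    cases coin <;> cases b <;> cases selB <;>
      simp [flatten, dsorStep, relaxedUpdate, updateTarget, greedyValue] <;> ring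
  · have hsu' : ¬ (s = i ∧ u = a) := fun h => hsu ⟨h.1.symm, h.2.symm⟩
    cases coin <;> cases b <;>
      simp [flatten, dsorStep, relaxedUpdate, hsu, hsu']

/-- The modulus of the SOR operator. -/
def FiniteMDP.sorModulus (M : FiniteMDP S A) (w : ℝ) : ℝ := 1 - w * (1 - M.γ)

/-- The sum of the absolute values of all rewards. -/
def FiniteMDP.rewardBound [Fintype A] (M : FiniteMDP S A) : ℝ := ∑ i, ∑ a, ∑ j, |M.r i a j|

lemma FiniteMDP.abs_reward_le [Fintype A] (M : FiniteMDP S A) (i : S) (a : A) (j : S) :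
    |M.r i a j| ≤ M.rewardBound := by
  have h1 : |M.r i a j| ≤ ∑ j, |M.r i a j| :=
    Finset.single_le_sum (f := fun j => |M.r i a j|) (fun _ _ => abs_nonneg _) (Finset.mem_univ j)
  have h2 : ∑ j, |M.r i a j| ≤ ∑ a, ∑ j, |M.r i a j| :=
    Finset.single_le_sum (f := fun a => ∑ j, |M.r i a j|)
      (fun _ _ => Finset.sum_nonneg fun _ _ => abs_nonneg _) (Finset.mem_univ a)
  have h3 : ∑ a, ∑ j, |M.r i a j| ≤ M.rewardBound :=
    Finset.single_le_sum (f := fun i => ∑ a, ∑ j, |M.r i a j|)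
      (fun _ _ => Finset.sum_nonneg fun _ _ => Finset.sum_nonneg fun _ _ => abs_nonneg _)
      (Finset.mem_univ i)
  linarith

lemma FiniteMDP.p_le_one (M : FiniteMDP S A) (i : S) (a : A) (j : S) : M.p i a j ≤ 1 := by
  rw [← M.p_sum i a]
  exact Finset.single_le_sum (fun j _ => M.p_nonneg i a j) (Finset.mem_univ j)

/-- This is the only use of the threshold `w*`: the current state keeps a nonnegative total weight,
even when `w > 1`. -/
lemma FiniteMDP.self_weight_nonneg [Finite A] (M : FiniteMDP S A) {w : ℝ} (hw : w ≤ M.wStar)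
    (i : S) (a : A) : 0 ≤ 1 - w + w * M.γ * M.p i a i := by
  have h1 : w ≤ 1 / (1 - M.γ * M.p i a i) :=
    hw.trans (ciInf_le (Set.finite_range _).bddBelow ((i, a) : S × A))
  have h2 : 0 < 1 - M.γ * M.p i a i := by
    have := mul_le_of_le_one_right M.γ_nonneg (M.p_le_one i a i)
    linarith [M.γ_lt_one]
  rw [le_div_iff₀ h2] at h1
  linarith

/-- The SOR average of a function on the states contracts with modulus `sorModulus`. -/
lemma FiniteMDP.abs_sorAverage_le [Finite A] (M : FiniteMDP S A) {w : ℝ} (hw0 : 0 < w)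
    (hw : w ≤ M.wStar) (D : S → ℝ) {B : ℝ} (hD : ∀ j, |D j| ≤ B) (i : S) (a : A) :
    |∑ j, M.p i a j * (w * M.γ * D j + (1 - w) * D i)| ≤ M.sorModulus w * B := by
  classical
  have hself := M.self_weight_nonneg hw i a
  have hsum : ∑ j ∈ Finset.univ.erase i, M.p i a j = 1 - M.p i a i := by
    rw [← M.p_sum i a, ← Finset.add_sum_erase _ _ (Finset.mem_univ i)]; ring
  -- The self-transition is merged with the `1 - w` term before absolute values are taken;
  -- separately they would cost `|1 - w|` and spoil the modulus when `w > 1`.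
  have e1 : ∑ j, M.p i a j * (w * M.γ * D j + (1 - w) * D i)
      = (1 - w + w * M.γ * M.p i a i) * D i
        + ∑ j ∈ Finset.univ.erase i, w * M.γ * M.p i a j * D j := by
    have : ∑ j, M.p i a j * (w * M.γ * D j + (1 - w) * D i)
        = ∑ j, w * M.γ * M.p i a j * D j + (∑ j, M.p i a j) * ((1 - w) * D i) := by
      rw [Finset.sum_mul, ← Finset.sum_add_distrib]
      exact Finset.sum_congr rfl fun j _ => by ring
    rw [this, M.p_sum, ← Finset.add_sum_erase _ _ (Finset.mem_univ i)]
    ring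
  have hwγ : 0 ≤ w * M.γ := mul_nonneg hw0.le M.γ_nonneg
  have h1 : |∑ j ∈ Finset.univ.erase i, w * M.γ * M.p i a j * D j|
      ≤ w * M.γ * (1 - M.p i a i) * B := by
    refine (Finset.abs_sum_le_sum_abs _ _).trans ?_
    rw [← hsum, Finset.mul_sum, Finset.sum_mul]
    refine Finset.sum_le_sum fun j _ => ?_
    have h0 : 0 ≤ w * M.γ * M.p i a j := mul_nonneg hwγ (M.p_nonneg _ _ _)
    rw [abs_mul, abs_of_nonneg h0]
    exact mul_le_mul_of_nonneg_left (hD j) h0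
  have h2 : |(1 - w + w * M.γ * M.p i a i) * D i| ≤ (1 - w + w * M.γ * M.p i a i) * B := by
    rw [abs_mul, abs_of_nonneg hself]
    exact mul_le_mul_of_nonneg_left (hD i) hself
  rw [e1, FiniteMDP.sorModulus]
  refine (abs_add_le _ _).trans ((add_le_add h2 h1).trans (le_of_eq ?_))
  ring

lemma FiniteMDP.sorModulus_nonneg [Finite A] (M : FiniteMDP S A) {w : ℝ} (hw0 : 0 < w)
    (hw : w ≤ M.wStar) (i : S) (a : A) : 0 ≤ M.sorModulus w := by
  have h1 := M.self_weight_nonneg hw i a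
  have h2 := mul_le_mul_of_nonneg_left (M.p_le_one i a i) (mul_nonneg hw0.le M.γ_nonneg)
  rw [FiniteMDP.sorModulus]
  linarith

lemma FiniteMDP.sorModulus_lt_one (M : FiniteMDP S A) {w : ℝ} (hw0 : 0 < w) :
    M.sorModulus w < 1 := by
  have := mul_pos hw0 (sub_pos.2 M.γ_lt_one)
  rw [FiniteMDP.sorModulus]
  linarith

variable [Fintype A]

lemma abs_greedyValue_le (g : (A → ℝ) → A) (selB : Bool) (x : Bool × S × A → ℝ) (b : Bool)
    (j : S) : |greedyValue g selB x b j| ≤ ‖x‖ :=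
  norm_le_pi_norm x _

/-- A growth constant for the targets. -/
def targetGrowth (M : FiniteMDP S A) (w : ℝ) : ℝ := w * M.rewardBound + w + |1 - w|

lemma FiniteMDP.rewardBound_nonneg (M : FiniteMDP S A) : 0 ≤ M.rewardBound :=
  Finset.sum_nonneg fun _ _ => Finset.sum_nonneg fun _ _ => Finset.sum_nonneg fun _ _ =>
    abs_nonneg _

lemma targetGrowth_nonneg (M : FiniteMDP S A) {w : ℝ} (hw0 : 0 < w) : 0 ≤ targetGrowth M w := by
  have := M.rewardBound_nonneg
  rw [targetGrowth]
  positivity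

lemma abs_updateTarget_le (M : FiniteMDP S A) {w : ℝ} (hw0 : 0 < w) (g : (A → ℝ) → A)
    (selB : Bool) (x : Bool × S × A → ℝ) (z : Bool × S × A) (j : S) :
    |updateTarget M w g selB x z j| ≤ targetGrowth M w * (1 + ‖x‖) := by
  have h1 := abs_greedyValue_le g selB x z.1 j
  have h2 := abs_greedyValue_le g selB x z.1 z.2.1
  have h3 := M.abs_reward_le z.2.1 z.2.2 j
  have hx := norm_nonneg x
  have hr := M.rewardBound_nonneg
  have h4 : |M.γ * greedyValue g selB x z.1 j| ≤ ‖x‖ := by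
    rw [abs_mul, abs_of_nonneg M.γ_nonneg]
    exact (mul_le_of_le_one_left (abs_nonneg _) M.γ_lt_one.le).trans h1
  have h5 : |w * (M.r z.2.1 z.2.2 j + M.γ * greedyValue g selB x z.1 j)|
      ≤ w * (M.rewardBound + ‖x‖) := by
    rw [abs_mul, abs_of_pos hw0]
    exact mul_le_mul_of_nonneg_left ((abs_add_le _ _).trans (add_le_add h3 h4)) hw0.le
  have h6 : |(1 - w) * greedyValue g selB x z.1 z.2.1| ≤ |1 - w| * ‖x‖ := by
    rw [abs_mul]
    exact mul_le_mul_of_nonneg_left h2 (abs_nonneg _)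
  refine (abs_add_le _ _).trans ((add_le_add h5 h6).trans ?_)
  have h7 : 0 ≤ w * M.rewardBound * ‖x‖ := by positivity
  have h8 := abs_nonneg (1 - w)
  rw [targetGrowth]
  nlinarith

lemma abs_meanTarget_le (M : FiniteMDP S A) {w : ℝ} (hw0 : 0 < w) (hw : w ≤ M.wStar)
    (g : (A → ℝ) → A) (selB : Bool) (x : Bool × S × A → ℝ) (z : Bool × S × A) :
    |meanTarget M w g selB x z| ≤ w * M.rewardBound + M.sorModulus w * ‖x‖ := by
  have e1 : meanTarget M w g selB x z = ∑ j, M.p z.2.1 z.2.2 j * (w * M.r z.2.1 z.2.2 j)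
      + ∑ j, M.p z.2.1 z.2.2 j * (w * M.γ * greedyValue g selB x z.1 j
        + (1 - w) * greedyValue g selB x z.1 z.2.1) := by
    rw [meanTarget, ← Finset.sum_add_distrib]
    exact Finset.sum_congr rfl fun j _ => by rw [updateTarget]; ring
  rw [e1]
  refine (abs_add_le _ _).trans (add_le_add ?_
    (M.abs_sorAverage_le hw0 hw _ (abs_greedyValue_le g selB x z.1) _ _))
  refine (Finset.abs_sum_le_sum_abs _ _).trans ?_
  calc ∑ j, |M.p z.2.1 z.2.2 j * (w * M.r z.2.1 z.2.2 j)|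
      ≤ ∑ j, M.p z.2.1 z.2.2 j * (w * M.rewardBound) := by
        refine Finset.sum_le_sum fun j _ => ?_
        rw [abs_mul, abs_of_nonneg (M.p_nonneg _ _ _), abs_mul, abs_of_pos hw0]
        exact mul_le_mul_of_nonneg_left
          (mul_le_mul_of_nonneg_left (M.abs_reward_le _ _ _) hw0.le) (M.p_nonneg _ _ _)
    _ = w * M.rewardBound := by rw [← Finset.sum_mul, M.p_sum, one_mul]

/-- The difference of the two greedy values is at most the distance of the two tables. -/
lemma abs_greedyValue_sub_le {g : (A → ℝ) → A} (hg : IsArgmaxRule g) (selB : Bool)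
    (x : Bool × S × A → ℝ) (j : S) :
    |greedyValue g selB x false j - greedyValue g selB x true j|
      ≤ ‖fun y : S × A => x (false, y) - x (true, y)‖ := by
  have hv : ∀ u, |x (false, j, u) - x (true, j, u)|
      ≤ ‖fun y : S × A => x (false, y) - x (true, y)‖ := fun u =>
    norm_le_pi_norm (fun y : S × A => x (false, y) - x (true, y)) (j, u)
  -- If both updates select with table `A`, the two tables are compared at one common action.
  -- Otherwise each selects with its own table, and maximality replaces the other table's maximiser
  -- by its own, once for each inequality.
  cases selB
  · have := hv (g fun u => x (true, j, u))
    rw [abs_sub_comm] at this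
    simpa [greedyValue] using this
  · have h1 := hv (g fun u => x (true, j, u))
    have h2 := hv (g fun u => x (false, j, u))
    have h3 := hg.le_max (fun u => x (true, j, u)) (g fun u => x (false, j, u))
    have h4 := hg.le_max (fun u => x (false, j, u)) (g fun u => x (true, j, u))
    simp only [greedyValue, Bool.not_false, Bool.not_true, Bool.or_false]
    rw [abs_le] at h1 h2 ⊢
    constructor <;> linarith

/-- The rewards cancel because both targets belong to the same pair; what remains is the SOR average
of the differences of greedy values. -/
lemma abs_meanTarget_sub_le (M : FiniteMDP S A) {w : ℝ} (hw0 : 0 < w) (hw : w ≤ M.wStar)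
    {g : (A → ℝ) → A} (hg : IsArgmaxRule g) (selB : Bool) (x : Bool × S × A → ℝ) (y : S × A) :
    |meanTarget M w g selB x (false, y) - meanTarget M w g selB x (true, y)|
      ≤ M.sorModulus w * ‖fun y : S × A => x (false, y) - x (true, y)‖ := by
  have e1 : meanTarget M w g selB x (false, y) - meanTarget M w g selB x (true, y)
      = ∑ j, M.p y.1 y.2 j * (w * M.γ *
          (greedyValue g selB x false j - greedyValue g selB x true j)
        + (1 - w) * (greedyValue g selB x false y.1 - greedyValue g selB x true y.1)) := by
    rw [meanTarget, meanTarget, ← Finset.sum_sub_distrib]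
    exact Finset.sum_congr rfl fun j _ => by simp only [updateTarget]; ring
  rw [e1]
  exact M.abs_sorAverage_le hw0 hw
    (fun j => greedyValue g selB x false j - greedyValue g selB x true j)
    (abs_greedyValue_sub_le hg selB x) y.1 y.2

end Tables

/-! ### Measurability of targets, step sizes and transitions -/

section Measurability

variable {Ω S A : Type*} [Fintype A] [DecidableEq A] {g : (A → ℝ) → A} {selB : Bool}
  {m : MeasurableSpace Ω} {x : Ω → Bool × S × A → ℝ}

/-- The action set carries no σ-algebra, so the evaluation at the greedy action is written as a
finite sum over the level sets of the rule. -/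
lemma measurable_greedyValue (hg : IsArgmaxRule g) (hx : ∀ z, Measurable[m] fun ω => x ω z)
    (b : Bool) (j : S) : Measurable[m] fun ω => greedyValue g selB (x ω) b j := by
  have e : (fun ω => greedyValue g selB (x ω) b j) = fun ω => ∑ a,
      if g (fun u => x ω (b || !selB, j, u)) = a then x ω (!b, j, a) else 0 := by
    classical
    ext ω
    simp [greedyValue]
  rw [e]
  refine Finset.measurable_fun_sum _ fun a _ => Measurable.ite ?_ (hx _) measurable_const
  exact (measurable_pi_iff.2 fun u => hx (b || !selB, j, u)) (hg.measurable_level a)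

variable [Fintype S] {M : FiniteMDP S A} {w : ℝ}

lemma measurable_updateTarget (hg : IsArgmaxRule g) (hx : ∀ z, Measurable[m] fun ω => x ω z)
    (z : Bool × S × A) (j : S) : Measurable[m] fun ω => updateTarget M w g selB (x ω) z j := by
  have h1 := measurable_greedyValue (selB := selB) hg hx z.1 j
  have h2 := measurable_greedyValue (selB := selB) hg hx z.1 z.2.1
  exact (((h1.const_mul _).const_add _).const_mul _).add (h2.const_mul _)

end Measurability

lemma visitStep_mem {Ω S A : Type*} [DecidableEq S] [DecidableEq A] {X : ℕ → Ω → S}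
    {U : ℕ → Ω → A} {β : ℕ → Ω → S → A → ℝ} {n : ℕ} {ω : Ω} (hβ : ∀ i a, 0 ≤ β n ω i a ∧ β n ω i a ≤ 1) (i : S) (a : A) :
    0 ≤ visitStep X U β n ω i a ∧ visitStep X U β n ω i a ≤ 1 := by
  rw [visitStep]
  split_ifs
  · exact hβ i a
  · exact ⟨le_rfl, zero_le_one⟩

lemma measurableSet_transition {Ω S A : Type*} [mΩ : MeasurableSpace Ω] {μ : Measure Ω}
    [Fintype S] {M : FiniteMDP S A} {ℱ : Filtration ℕ mΩ} {Q₀ : Ω → TablePair S A}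
    {X : ℕ → Ω → S} {U : ℕ → Ω → A} {β : ℕ → Ω → S → A → ℝ} {coin : ℕ → Ω → Bool}
    (h : IsDSORSampling M μ ℱ Q₀ X U β coin) (n : ℕ) (j : S)
    (c : Bool) : MeasurableSet[ℱ (n + 1)] {ω | X (n + 1) ω = j ∧ coin n ω = c} :=
  (h.state_adapted (n + 1) j).inter (h.coin_adapted n c)

lemma measurable_visitStep {Ω S A : Type*} [mΩ : MeasurableSpace Ω] {μ : Measure Ω}
    [Fintype S] [DecidableEq S] [DecidableEq A] {M : FiniteMDP S A} {ℱ : Filtration ℕ mΩ}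
    {Q₀ : Ω → TablePair S A} {X : ℕ → Ω → S} {U : ℕ → Ω → A} {β : ℕ → Ω → S → A → ℝ}
    {coin : ℕ → Ω → Bool} (h : IsDSORSampling M μ ℱ Q₀ X U β coin) (n : ℕ) (i : S) (a : A) :
    Measurable[ℱ n] fun ω => visitStep X U β n ω i a :=
  Measurable.ite ((h.state_adapted n i).inter (h.action_adapted n a)) (h.step_adapted n i a)
    measurable_const

/-- The sampled increment, written as a sum over the possible transitions. -/
lemma coin_ite_eq_sum {Ω S : Type*} [Fintype S] [DecidableEq S] {X : ℕ → Ω → S}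
    {coin : ℕ → Ω → Bool} (f : S → ℝ) (n : ℕ) (ω : Ω) (b : Bool) :
    (if coin n ω = b then f (X (n + 1) ω) else 0)
      = ∑ j, {ω | X (n + 1) ω = j ∧ coin n ω = b}.indicator (fun _ => (1 : ℝ)) ω * f j := by
  simp only [Set.indicator_apply, Set.mem_ofPred_eq, ite_mul, one_mul, zero_mul]
  by_cases hc : coin n ω = b <;> simp [hc]

/-! ### The iterates and their martingale noise -/

section Sampling

variable {Ω S A : Type*} [Fintype S] [DecidableEq S] [DecidableEq A] {M : FiniteMDP S A} {w : ℝ}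
  {g : (A → ℝ) → A} {selB : Bool} {Q₀ : Ω → TablePair S A} {X : ℕ → Ω → S} {U : ℕ → Ω → A}
  {β : ℕ → Ω → S → A → ℝ} {coin : ℕ → Ω → Bool}

/-- The iterates of double SOR Q-learning as vectors. -/
noncomputable def flatIterate (M : FiniteMDP S A) (w : ℝ) (g : (A → ℝ) → A) (selB : Bool)
    (Q₀ : Ω → TablePair S A) (X : ℕ → Ω → S) (U : ℕ → Ω → A) (β : ℕ → Ω → S → A → ℝ)
    (coin : ℕ → Ω → Bool) (n : ℕ) (ω : Ω) : Bool × S × A → ℝ :=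
  flatten (dsorIterate M w g selB Q₀ X U β coin n ω)

lemma flatIterate_succ (n : ℕ) (ω : Ω) (z : Bool × S × A) :
    flatIterate M w g selB Q₀ X U β coin (n + 1) ω z = flatIterate M w g selB Q₀ X U β coin n ω z +
      visitStep X U β n ω z.2.1 z.2.2 * (if coin n ω = z.1 then
        updateTarget M w g selB (flatIterate M w g selB Q₀ X U β coin n ω) z (X (n + 1) ω)
          - flatIterate M w g selB Q₀ X U β coin n ω z else 0) := by
  rw [flatIterate, dsorIterate, flatten_dsorStep]
  congr 2
  rw [visitStep]
  split_ifs with h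
  · rw [h.1, h.2]
  · rfl

/-- The martingale differences of double SOR Q-learning. -/
noncomputable def dsorNoise (M : FiniteMDP S A) (w : ℝ) (g : (A → ℝ) → A) (selB : Bool)
    (Q₀ : Ω → TablePair S A) (X : ℕ → Ω → S) (U : ℕ → Ω → A) (β : ℕ → Ω → S → A → ℝ)
    (coin : ℕ → Ω → Bool) (n : ℕ) (ω : Ω) (z : Bool × S × A) : ℝ :=
  visitStep X U β n ω z.2.1 z.2.2 * ((if coin n ω = z.1 then
        updateTarget M w g selB (flatIterate M w g selB Q₀ X U β coin n ω) z (X (n + 1) ω)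
          - flatIterate M w g selB Q₀ X U β coin n ω z else 0)
    - 1 / 2 * (meanTarget M w g selB (flatIterate M w g selB Q₀ X U β coin n ω) z
      - flatIterate M w g selB Q₀ X U β coin n ω z))

/-- The noise as a sum over the possible transitions. -/
lemma dsorNoise_eq (n : ℕ) (ω : Ω) (z : Bool × S × A) :
    dsorNoise M w g selB Q₀ X U β coin n ω z = ∑ j,
      (visitStep X U β n ω z.2.1 z.2.2 *
          (updateTarget M w g selB (flatIterate M w g selB Q₀ X U β coin n ω) z j
            - flatIterate M w g selB Q₀ X U β coin n ω z)) *
        ({ω | X (n + 1) ω = j ∧ coin n ω = z.1}.indicator (fun _ => (1 : ℝ)) ω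
          - M.p z.2.1 z.2.2 j * (1 / 2)) := by
  set x := flatIterate M w g selB Q₀ X U β coin n ω with hx
  have e1 : meanTarget M w g selB x z - x z
      = ∑ j, M.p z.2.1 z.2.2 j * (updateTarget M w g selB x z j - x z) := by
    simp only [mul_sub, Finset.sum_sub_distrib, ← Finset.sum_mul, M.p_sum, one_mul, meanTarget]
  rw [dsorNoise, ← hx, e1, coin_ite_eq_sum (fun j => updateTarget M w g selB x z j - x z),
    Finset.mul_sum, ← Finset.sum_sub_distrib, Finset.mul_sum]
  exact Finset.sum_congr rfl fun j _ => by ring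

variable [Fintype A]

/-- The one-step growth of the iterates. -/
lemma one_add_norm_flatIterate_succ_le (hw0 : 0 < w) {n : ℕ} {ω : Ω}
    (hβ : ∀ i a, 0 ≤ β n ω i a ∧ β n ω i a ≤ 1) :
    1 + ‖flatIterate M w g selB Q₀ X U β coin (n + 1) ω‖
      ≤ (2 + targetGrowth M w) * (1 + ‖flatIterate M w g selB Q₀ X U β coin n ω‖) := by
  set x := flatIterate M w g selB Q₀ X U β coin n ω with hx
  have h0 := norm_nonneg x
  have hK := targetGrowth_nonneg M hw0
  have hprod : 0 ≤ targetGrowth M w * (1 + ‖x‖) := by positivity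
  have : ‖flatIterate M w g selB Q₀ X U β coin (n + 1) ω‖
      ≤ ‖x‖ + (targetGrowth M w * (1 + ‖x‖) + ‖x‖) := by
    refine (pi_norm_le_iff_of_nonneg (by linarith)).2 fun z => ?_
    rw [flatIterate_succ, ← hx]
    have hα := visitStep_mem (X := X) (U := U) hβ z.2.1 z.2.2
    have h1 := abs_updateTarget_le M hw0 g selB x z (X (n + 1) ω)
    have h2 : |x z| ≤ ‖x‖ := norm_le_pi_norm x z
    have h3 : |if coin n ω = z.1 then updateTarget M w g selB x z (X (n + 1) ω) - x z else 0|
        ≤ targetGrowth M w * (1 + ‖x‖) + ‖x‖ := by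
      split_ifs
      · exact (abs_sub _ _).trans (add_le_add h1 h2)
      · rw [abs_zero]; linarith
    refine (abs_add_le _ _).trans (add_le_add h2 ?_)
    rw [abs_mul, abs_of_nonneg hα.1]
    exact (mul_le_of_le_one_left (abs_nonneg _) hα.2).trans h3
  linarith

lemma one_add_norm_flatIterate_le (hw0 : 0 < w) {ω : Ω}
    (hβ : ∀ n i a, 0 ≤ β n ω i a ∧ β n ω i a ≤ 1) (n : ℕ) :
    1 + ‖flatIterate M w g selB Q₀ X U β coin n ω‖
      ≤ (2 + targetGrowth M w) ^ n * (1 + ‖flatten (Q₀ ω)‖) := by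
  induction n with
  | zero => simp [flatIterate, dsorIterate]
  | succ n ih =>
    have hK := targetGrowth_nonneg M hw0
    rw [pow_succ', mul_assoc]
    exact (one_add_norm_flatIterate_succ_le hw0 (hβ n)).trans
      (mul_le_mul_of_nonneg_left ih (by linarith))

/-- The growth constant of the noise. -/
def noiseGrowth (M : FiniteMDP S A) (w : ℝ) : ℝ :=
  2 * targetGrowth M w + w * M.rewardBound + 4

/-- Relative to the halved step, the sampled increment counts twice and its mean once; this explains
the doubled `targetGrowth` and the `4 = 2 + 2` multiples of `‖x‖` in `noiseGrowth`. -/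
lemma abs_dsorNoise_le (hw0 : 0 < w) (hw : w ≤ M.wStar) {n : ℕ} {ω : Ω}
    (hβ : ∀ i a, 0 ≤ β n ω i a ∧ β n ω i a ≤ 1) (z : Bool × S × A) :
    |dsorNoise M w g selB Q₀ X U β coin n ω z| ≤ visitStep X U β n ω z.2.1 z.2.2 / 2 *
      (noiseGrowth M w * (1 + ‖flatIterate M w g selB Q₀ X U β coin n ω‖)) := by
  set x := flatIterate M w g selB Q₀ X U β coin n ω with hx
  have hα := visitStep_mem (X := X) (U := U) hβ z.2.1 z.2.2
  have h1 := abs_updateTarget_le M hw0 g selB x z (X (n + 1) ω)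
  have h2 : |x z| ≤ ‖x‖ := norm_le_pi_norm x z
  have h3 := abs_meanTarget_le M hw0 hw g selB x z
  have h0 := norm_nonneg x
  have hT : 0 ≤ targetGrowth M w * (1 + ‖x‖) :=
    mul_nonneg (targetGrowth_nonneg M hw0) (by linarith)
  have hr : 0 ≤ w * M.rewardBound * ‖x‖ :=
    mul_nonneg (mul_nonneg hw0.le M.rewardBound_nonneg) h0
  have hκ := mul_le_mul_of_nonneg_right (M.sorModulus_lt_one hw0).le h0
  have h4 : |if coin n ω = z.1 then updateTarget M w g selB x z (X (n + 1) ω) - x z else 0|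
      ≤ targetGrowth M w * (1 + ‖x‖) + ‖x‖ := by
    split_ifs
    · exact (abs_sub _ _).trans (add_le_add h1 h2)
    · rw [abs_zero]; linarith
  have h5 : |1 / 2 * (meanTarget M w g selB x z - x z)|
      ≤ 1 / 2 * (w * M.rewardBound + M.sorModulus w * ‖x‖ + ‖x‖) := by
    rw [abs_mul, abs_of_pos (by norm_num : (0 : ℝ) < 1 / 2)]
    exact mul_le_mul_of_nonneg_left ((abs_sub _ _).trans (add_le_add h3 h2)) (by norm_num)
  have h6 := (abs_sub (if coin n ω = z.1 then
    updateTarget M w g selB x z (X (n + 1) ω) - x z else 0)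
    (1 / 2 * (meanTarget M w g selB x z - x z))).trans (add_le_add h4 h5)
  rw [dsorNoise, ← hx, abs_mul, abs_of_nonneg hα.1]
  calc _ ≤ visitStep X U β n ω z.2.1 z.2.2 * (noiseGrowth M w * (1 + ‖x‖) / 2) := by
        refine mul_le_mul_of_nonneg_left (h6.trans ?_) hα.1
        rw [noiseGrowth]
        linarith
    _ = _ := by ring

variable [mΩ : MeasurableSpace Ω] {μ : Measure Ω} {ℱ : Filtration ℕ mΩ}

lemma measurable_flatIterate (h : IsDSORSampling M μ ℱ Q₀ X U β coin) (hg : IsArgmaxRule g)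
    (n : ℕ) (z : Bool × S × A) :
    Measurable[ℱ n] fun ω => flatIterate M w g selB Q₀ X U β coin n ω z := by
  induction n generalizing z with
  | zero =>
    obtain ⟨b, s, u⟩ := z
    cases b
    · simpa [flatIterate, dsorIterate, flatten] using (h.init_measurable s u).2
    · simpa [flatIterate, dsorIterate, flatten] using (h.init_measurable s u).1
  | succ n ih =>
    have hle : ℱ n ≤ ℱ (n + 1) := ℱ.mono n.le_succ
    simp only [flatIterate_succ]
    refine ((ih z).mono hle le_rfl).add (((measurable_visitStep h n _ _).mono hle le_rfl).mul ?_)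
    have e := fun ω => coin_ite_eq_sum (X := X) (coin := coin) (fun j => updateTarget M w g selB
      (flatIterate M w g selB Q₀ X U β coin n ω) z j - flatIterate M w g selB Q₀ X U β coin n ω z)
      n ω z.1
    simp only [e]
    refine Finset.measurable_fun_sum _ fun j _ => Measurable.mul ?_ ?_
    · exact measurable_const.indicator (measurableSet_transition h n j z.1)
    · exact ((measurable_updateTarget hg ih z j).sub (ih z)).mono hle le_rfl

lemma measurable_dsorNoise (h : IsDSORSampling M μ ℱ Q₀ X U β coin) (hg : IsArgmaxRule g)
    (n : ℕ) (z : Bool × S × A) :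
    Measurable[ℱ (n + 1)] fun ω => dsorNoise M w g selB Q₀ X U β coin n ω z := by
  have hle : ℱ n ≤ ℱ (n + 1) := ℱ.mono n.le_succ
  have hx := measurable_flatIterate (w := w) (selB := selB) h hg n
  simp only [dsorNoise_eq]
  refine Finset.measurable_fun_sum _ fun j _ => Measurable.mul ?_ ?_
  · exact ((measurable_visitStep h n _ _).mul
      ((measurable_updateTarget hg hx z j).sub (hx z))).mono hle le_rfl
  · exact (measurable_const.indicator (measurableSet_transition h n j z.1)).sub measurable_const

variable [IsProbabilityMeasure μ]

lemma condExp_dsorNoise (h : IsDSORSampling M μ ℱ Q₀ X U β coin) (hg : IsArgmaxRule g)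
    (hw0 : 0 < w) {n : ℕ} (hβ : ∀ ω i a, 0 ≤ β n ω i a ∧ β n ω i a ≤ 1) {R : ℝ}
    (hR : ∀ ω, ‖flatIterate M w g selB Q₀ X U β coin n ω‖ ≤ R) (z : Bool × S × A) :
    μ[fun ω => dsorNoise M w g selB Q₀ X U β coin n ω z | ℱ n] =ᵐ[μ] 0 := by
  set x := flatIterate M w g selB Q₀ X U β coin n with hx
  have hxm := measurable_flatIterate (w := w) (selB := selB) h hg n
  set H : S → Ω → ℝ := fun j ω => visitStep X U β n ω z.2.1 z.2.2 *
    (updateTarget M w g selB (x ω) z j - x ω z) with hH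
  set E : S → Ω → ℝ := fun j =>
    {ω | X (n + 1) ω = j ∧ coin n ω = z.1}.indicator (fun _ => (1 : ℝ)) with hE
  have hHm : ∀ j, Measurable[ℱ n] (H j) := fun j =>
    (measurable_visitStep h n _ _).mul ((measurable_updateTarget hg hxm z j).sub (hxm z))
  have hHb : ∀ j ω, |H j ω| ≤ targetGrowth M w * (1 + R) + R := by
    intro j ω
    have hα := visitStep_mem (X := X) (U := U) (hβ ω) z.2.1 z.2.2
    have h2 : |x ω z| ≤ ‖x ω‖ := norm_le_pi_norm (x ω) z
    have h3 := mul_le_mul_of_nonneg_left (hR ω) (targetGrowth_nonneg M hw0)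
    simp only [hH]
    rw [abs_mul, abs_of_nonneg hα.1]
    refine (mul_le_of_le_one_left (abs_nonneg _) hα.2).trans ((abs_sub _ _).trans ?_)
    have h4 := abs_updateTarget_le M hw0 g selB (x ω) z j
    linarith [hR ω]
  have hEm : ∀ j, Measurable (E j) := fun j =>
    measurable_const.indicator (ℱ.le _ _ (measurableSet_transition h n j z.1))
  have hEi : ∀ j, Integrable (E j) μ := fun j =>
    integrable_of_abs_le (hEm j) ⟨1, fun ω => by
      simp only [hE, Set.indicator_apply]
      split_ifs <;> simp⟩
  have hHi : ∀ j, Integrable (H j) μ := fun j =>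
    integrable_of_abs_le ((hHm j).mono (ℱ.le _) le_rfl) ⟨_, hHb j⟩
  have hterm : ∀ j, μ[H j * (E j - fun _ => M.p z.2.1 z.2.2 j * (1 / 2)) | ℱ n] =ᵐ[μ] 0 := by
    intro j
    have h1 := condExp_stronglyMeasurable_mul_of_bound (ℱ.le n) (μ := μ) (hHm j).stronglyMeasurable
      ((hEi j).sub (integrable_const (M.p z.2.1 z.2.2 j * (1 / 2)))) _
      (Eventually.of_forall (hHb j))
    have h2 := condExp_sub (hEi j) (integrable_const (μ := μ) (M.p z.2.1 z.2.2 j * (1 / 2))) (ℱ n)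
    rw [condExp_const (ℱ.le n)] at h2
    filter_upwards [h1, h2, h.transition n j z.1] with ω h3 h4 h5
    rw [h3, Pi.mul_apply, h4, Pi.sub_apply, h5]
    -- The kernel at the visited pair and the kernel at `z` agree exactly where the step size can be
    -- nonzero.
    simp only [hH, visitStep]
    split_ifs with hv
    · rw [hv.1, hv.2]; simp
    · simp
  have e : (fun ω => dsorNoise M w g selB Q₀ X U β coin n ω z)
      = ∑ j, H j * (E j - fun _ => M.p z.2.1 z.2.2 j * (1 / 2)) := by
    ext ω
    rw [dsorNoise_eq, Finset.sum_apply]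
    rfl
  rw [e]
  refine (condExp_finsetSum (fun j _ => ?_) (ℱ n)).trans ?_
  · exact ((hEi j).sub (integrable_const _)).bdd_mul (c := targetGrowth M w * (1 + R) + R)
      ((hHm j).mono (ℱ.le _) le_rfl).aestronglyMeasurable (Eventually.of_forall (hHb j))
  · filter_upwards [ae_all_iff.2 hterm] with ω hω
    rw [Finset.sum_apply]
    exact Finset.sum_eq_zero fun j _ => hω j

/-- Double SOR Q-learning with bounded initial tables is a relaxation scheme. -/
lemma isRelaxationScheme_flatIterate (h : IsDSORSampling M μ ℱ Q₀ X U β coin)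
    (hg : IsArgmaxRule g) (hw0 : 0 < w) (hw : w ≤ M.wStar)
    (hβ : ∀ ω n i a, 0 ≤ β n ω i a ∧ β n ω i a ≤ 1) {R : ℝ} (hR : ∀ ω, ‖flatten (Q₀ ω)‖ ≤ R) :
    IsRelaxationScheme μ ℱ (flatIterate M w g selB Q₀ X U β coin)
      (fun n ω z => visitStep X U β n ω z.2.1 z.2.2 / 2)
      (fun n ω => meanTarget M w g selB (flatIterate M w g selB Q₀ X U β coin n ω))
      (dsorNoise M w g selB Q₀ X U β coin) (M.sorModulus w) (w * M.rewardBound)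
      (noiseGrowth M w) := by
  have hbdd : ∀ n ω, ‖flatIterate M w g selB Q₀ X U β coin n ω‖
      ≤ (2 + targetGrowth M w) ^ n * (1 + R) := fun n ω => by
    have h1 := one_add_norm_flatIterate_le (M := M) (g := g) (selB := selB) (Q₀ := Q₀) (X := X)
      (U := U) (coin := coin) hw0 (hβ ω) n
    have hK := targetGrowth_nonneg M hw0
    have h2 : (2 + targetGrowth M w) ^ n * (1 + ‖flatten (Q₀ ω)‖)
        ≤ (2 + targetGrowth M w) ^ n * (1 + R) := by gcongr; exact hR ω
    linarith
  refine ⟨fun n ω z => ?_, fun n ω z => ?_, fun n ω z => abs_meanTarget_le M hw0 hw g selB _ z,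
    fun n ω z => abs_dsorNoise_le hw0 hw (hβ ω n) z,
    measurable_flatIterate h hg, measurable_dsorNoise h hg,
    fun n z => condExp_dsorNoise h hg hw0 (fun ω => hβ ω n) (hbdd n) z,
    fun n => ⟨_, hbdd n⟩⟩
  · have := visitStep_mem (X := X) (U := U) (hβ ω n) z.2.1 z.2.2
    constructor <;> linarith
  · rw [flatIterate_succ, dsorNoise]; ring

end Sampling

/-! ### Localisation -/

/-- The event that the initial tables are bounded by `R`. -/
def initEvent {Ω S A : Type*} (Q₀ : Ω → TablePair S A) (R : ℝ) : Set Ω :=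
  {ω | ∀ z, |flatten (Q₀ ω) z| ≤ R}

/-- The initial tables, replaced by `0` where they are large. -/
noncomputable def localInit {Ω S A : Type*} (Q₀ : Ω → TablePair S A) (R : ℝ) : Ω → TablePair S A :=
  (initEvent Q₀ R).indicator Q₀

lemma localInit_fst {Ω S A : Type*} (Q₀ : Ω → TablePair S A) (R : ℝ) (i : S) (a : A) :
    (fun ω => (localInit Q₀ R ω).1 i a)
      = (initEvent Q₀ R).indicator fun ω => (Q₀ ω).1 i a := by
  ext ω
  by_cases hω : ω ∈ initEvent Q₀ R <;> simp [localInit, hω]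

lemma localInit_snd {Ω S A : Type*} (Q₀ : Ω → TablePair S A) (R : ℝ) (i : S) (a : A) :
    (fun ω => (localInit Q₀ R ω).2 i a)
      = (initEvent Q₀ R).indicator fun ω => (Q₀ ω).2 i a := by
  ext ω
  by_cases hω : ω ∈ initEvent Q₀ R <;> simp [localInit, hω]

lemma norm_flatten_localInit_le {Ω S A : Type*} [Fintype S] [Fintype A]
    {Q₀ : Ω → TablePair S A} {R : ℝ} (hR : 0 ≤ R) (ω : Ω) : ‖flatten (localInit Q₀ R ω)‖ ≤ R := by
  refine (pi_norm_le_iff_of_nonneg hR).2 fun z => ?_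
  by_cases hω : ω ∈ initEvent Q₀ R
  · rw [localInit, Set.indicator_of_mem hω]
    exact hω z
  · rw [localInit, Set.indicator_of_notMem hω]
    simpa [flatten] using hR

lemma measurableSet_initEvent {Ω S A : Type*} [Finite S] [Finite A] {m : MeasurableSpace Ω}
    {Q₀ : Ω → TablePair S A} {R : ℝ} (hQ : ∀ z, Measurable[m] fun ω => flatten (Q₀ ω) z) :
    MeasurableSet[m] (initEvent Q₀ R) := by
  have : initEvent Q₀ R = ⋂ z, {ω | |flatten (Q₀ ω) z| ≤ R} := by
    ext ω; simp [initEvent]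
  rw [this]
  exact MeasurableSet.iInter fun z => measurableSet_le (hQ z).abs measurable_const

lemma measurable_flatten_init {Ω S A : Type*} [mΩ : MeasurableSpace Ω] {μ : Measure Ω}
    [Fintype S] {M : FiniteMDP S A} {ℱ : Filtration ℕ mΩ} {Q₀ : Ω → TablePair S A}
    {X : ℕ → Ω → S} {U : ℕ → Ω → A} {β : ℕ → Ω → S → A → ℝ} {coin : ℕ → Ω → Bool}
    (h : IsDSORSampling M μ ℱ Q₀ X U β coin) (z : Bool × S × A) :
    Measurable[ℱ 0] fun ω => flatten (Q₀ ω) z := by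
  obtain ⟨b, s, u⟩ := z
  cases b
  · simpa [flatten] using (h.init_measurable s u).2
  · simpa [flatten] using (h.init_measurable s u).1

lemma integrable_flatten_init {Ω S A : Type*} [mΩ : MeasurableSpace Ω] {μ : Measure Ω}
    [Fintype S] {M : FiniteMDP S A} {ℱ : Filtration ℕ mΩ} {Q₀ : Ω → TablePair S A}
    {X : ℕ → Ω → S} {U : ℕ → Ω → A} {β : ℕ → Ω → S → A → ℝ} {coin : ℕ → Ω → Bool}
    (h : IsDSORSampling M μ ℱ Q₀ X U β coin) (z : Bool × S × A) :
    Integrable (fun ω => flatten (Q₀ ω) z) μ := by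
  obtain ⟨b, s, u⟩ := z
  cases b
  · simpa [flatten] using (h.init_integrable s u).2
  · simpa [flatten] using (h.init_integrable s u).1

section Localisation

variable {Ω S A : Type*} [Fintype S] [DecidableEq S] [Fintype A] [DecidableEq A]

/-- The sum of the squared step sizes at time `n`. -/
noncomputable def stepEnergy (X : ℕ → Ω → S) (U : ℕ → Ω → A) (β : ℕ → Ω → S → A → ℝ) (n : ℕ)
    (ω : Ω) : ℝ :=
  ∑ z : Bool × S × A, (visitStep X U β n ω z.2.1 z.2.2 / 2) ^ 2

/-- The event that up to time `n` the step sizes lie in `[0, 1]` and their squares have a small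
sum after time `N`, and that the initial tables are bounded by `R`. -/
def localEvent (Q₀ : Ω → TablePair S A) (X : ℕ → Ω → S) (U : ℕ → Ω → A)
    (β : ℕ → Ω → S → A → ℝ) (R ε : ℝ) (N n : ℕ) : Set Ω :=
  {ω | ω ∈ initEvent Q₀ R ∧ (∀ k ≤ n, ∀ i a, 0 ≤ β k ω i a ∧ β k ω i a ≤ 1) ∧
    ∑ k ∈ Finset.Ico N (n + 1), stepEnergy X U β k ω ≤ ε}

/-- The step sizes, replaced by `0` from the first exit of the local event on. -/
noncomputable def localStep (Q₀ : Ω → TablePair S A) (X : ℕ → Ω → S) (U : ℕ → Ω → A)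
    (β : ℕ → Ω → S → A → ℝ) (R ε : ℝ) (N n : ℕ) (ω : Ω) (i : S) (a : A) : ℝ :=
  (localEvent Q₀ X U β R ε N n).indicator (fun ω => β n ω i a) ω

variable {Q₀ : Ω → TablePair S A} {X : ℕ → Ω → S} {U : ℕ → Ω → A} {β : ℕ → Ω → S → A → ℝ}
  {R ε : ℝ} {N : ℕ}

lemma stepEnergy_nonneg (n : ℕ) (ω : Ω) : 0 ≤ stepEnergy X U β n ω :=
  Finset.sum_nonneg fun _ _ => sq_nonneg _

lemma localEvent_antitone : Antitone (localEvent Q₀ X U β R ε N) := by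
  intro m n hmn ω hω
  refine ⟨hω.1, fun k hk => hω.2.1 k (hk.trans hmn), le_trans ?_ hω.2.2⟩
  exact Finset.sum_le_sum_of_subset_of_nonneg (Finset.Ico_subset_Ico_right (by omega))
    fun k _ _ => stepEnergy_nonneg k ω

lemma localStep_of_mem {n : ℕ} {ω : Ω} (hω : ω ∈ localEvent Q₀ X U β R ε N n) :
    localStep Q₀ X U β R ε N n ω = β n ω := by
  ext i a
  rw [localStep, Set.indicator_of_mem hω]

lemma localStep_of_notMem {n : ℕ} {ω : Ω} (hω : ω ∉ localEvent Q₀ X U β R ε N n) :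
    localStep Q₀ X U β R ε N n ω = 0 := by
  ext i a
  rw [localStep, Set.indicator_of_notMem hω]
  rfl

lemma localStep_mem (n : ℕ) (ω : Ω) (i : S) (a : A) :
    0 ≤ localStep Q₀ X U β R ε N n ω i a ∧ localStep Q₀ X U β R ε N n ω i a ≤ 1 := by
  by_cases hω : ω ∈ localEvent Q₀ X U β R ε N n
  · rw [localStep_of_mem hω]
    exact hω.2.1 n le_rfl i a
  · rw [localStep_of_notMem hω]
    exact ⟨le_rfl, zero_le_one⟩

/-- The event at time `T` already tests the step of time `T`, so the step that would exceed the
budget is itself suppressed and there is no overshoot. -/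
lemma sum_stepEnergy_localStep_le (hε : 0 ≤ ε) (T : ℕ) (ω : Ω) :
    ∑ k ∈ Finset.Ico N T, stepEnergy X U (localStep Q₀ X U β R ε N) k ω ≤ ε := by
  induction T with
  | zero => simpa using hε
  | succ T ih =>
    by_cases hω : ω ∈ localEvent Q₀ X U β R ε N T
    · refine le_trans (le_of_eq (Finset.sum_congr rfl fun k hk => ?_)) hω.2.2
      have hk' : k ≤ T := by have := (Finset.mem_Ico.1 hk).2; omega
      simp only [stepEnergy, visitStep, localStep_of_mem (localEvent_antitone hk' hω)]
    · rcases le_or_gt N T with hNT | hNT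
      · rw [Finset.sum_Ico_succ_top hNT]
        have : stepEnergy X U (localStep Q₀ X U β R ε N) T ω = 0 := by
          simp [stepEnergy, visitStep, localStep_of_notMem hω]
        rw [this, add_zero]
        exact ih
      · rw [Finset.Ico_eq_empty (by omega), Finset.sum_empty]
        exact hε

lemma dsorIterate_local {M : FiniteMDP S A} {w : ℝ} {g : (A → ℝ) → A} {selB : Bool}
    {coin : ℕ → Ω → Bool} {n : ℕ} {ω : Ω} (hω : ω ∈ localEvent Q₀ X U β R ε N n) :
    dsorIterate M w g selB (localInit Q₀ R) X U (localStep Q₀ X U β R ε N) coin n ω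
      = dsorIterate M w g selB Q₀ X U β coin n ω := by
  induction n with
  | zero => exact Set.indicator_of_mem hω.1 _
  | succ n ih =>
    have hn := localEvent_antitone n.le_succ hω
    rw [dsorIterate, dsorIterate, ih hn, localStep_of_mem hn]

section Measurability

variable {m : MeasurableSpace Ω}

/-- The σ-algebra is left free: `ℱ n` is needed for the adaptedness of the localised steps,
`observedSigma` for conditioning on `𝒢 n`. -/
lemma measurableSet_localEvent {n : ℕ} (hQ : ∀ z, Measurable[m] fun ω => flatten (Q₀ ω) z)
    (hX : ∀ k ≤ n, ∀ i, MeasurableSet[m] {ω | X k ω = i})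
    (hU : ∀ k ≤ n, ∀ a, MeasurableSet[m] {ω | U k ω = a})
    (hβ : ∀ k ≤ n, ∀ i a, Measurable[m] fun ω => β k ω i a) :
    MeasurableSet[m] (localEvent Q₀ X U β R ε N n) := by
  have e : localEvent Q₀ X U β R ε N n = initEvent Q₀ R ∩
      ((⋂ k, ⋂ (_ : k ≤ n), ⋂ i, ⋂ a, {ω | 0 ≤ β k ω i a} ∩ {ω | β k ω i a ≤ 1}) ∩
        {ω | ∑ k ∈ Finset.Ico N (n + 1), stepEnergy X U β k ω ≤ ε}) := by
    ext ω
    simp only [localEvent, Set.mem_ofPred_eq, Set.mem_inter_iff, Set.mem_iInter]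
  rw [e]
  refine (measurableSet_initEvent hQ).inter (MeasurableSet.inter ?_ ?_)
  · refine MeasurableSet.iInter fun k => MeasurableSet.iInter fun hk => MeasurableSet.iInter fun i =>
      MeasurableSet.iInter fun a => ?_
    exact (measurableSet_le measurable_const (hβ k hk i a)).inter
      (measurableSet_le (hβ k hk i a) measurable_const)
  · refine measurableSet_le (Finset.measurable_fun_sum _ fun k hk => ?_) measurable_const
    have hk' : k ≤ n := by have := (Finset.mem_Ico.1 hk).2; omega
    refine Finset.measurable_fun_sum _ fun z _ => Measurable.pow_const (Measurable.div_const ?_ _) _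
    exact Measurable.ite ((hX k hk' _).inter (hU k hk' _)) (hβ k hk' _ _) measurable_const

end Measurability

/-- Almost every path stays in one of the local events. -/
lemma exists_forall_mem_localEvent {ω : Ω} (hε : 0 < ε)
    (hβ : ∀ n i a, 0 ≤ β n ω i a ∧ β n ω i a ≤ 1)
    (hsq : ∀ i a, Summable fun n => visitStep X U β n ω i a ^ 2) :
    ∃ R N : ℕ, ∀ n, ω ∈ localEvent Q₀ X U β R ε N n := by
  obtain ⟨R, hR⟩ := exists_nat_ge ‖flatten (Q₀ ω)‖
  have hsum : Summable fun n => stepEnergy X U β n ω := by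
    refine summable_sum fun z _ => ?_
    simp only [div_pow]
    exact (hsq z.2.1 z.2.2).div_const _
  obtain ⟨N, hN⟩ := ((tendsto_sum_nat_add fun n => stepEnergy X U β n ω).eventually_le_const
    hε).exists
  refine ⟨R, N, fun n => ⟨fun z => (norm_le_pi_norm (flatten (Q₀ ω)) z).trans hR,
    fun k _ => hβ k, le_trans ?_ hN⟩⟩
  rw [Finset.sum_Ico_eq_sum_range]
  simp only [add_comm N]
  exact ((summable_nat_add_iff N).2 hsum).sum_le_tsum _ fun k _ => stepEnergy_nonneg _ ω

variable [mΩ : MeasurableSpace Ω] {μ : Measure Ω} {ℱ : Filtration ℕ mΩ} {M : FiniteMDP S A}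
  {coin : ℕ → Ω → Bool}

/-- The localised algorithm is again double SOR Q-learning. -/
lemma IsDSORSampling.localise (h : IsDSORSampling M μ ℱ Q₀ X U β coin) :
    IsDSORSampling M μ ℱ (localInit Q₀ R) X U (localStep Q₀ X U β R ε N) coin where
  init_measurable i a := by
    have hm := measurableSet_initEvent (R := R) (measurable_flatten_init h)
    rw [localInit_fst, localInit_snd]
    exact ⟨(h.init_measurable i a).1.indicator hm, (h.init_measurable i a).2.indicator hm⟩
  init_integrable i a := by
    have hm := ℱ.le 0 _ (measurableSet_initEvent (R := R) (measurable_flatten_init h))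
    rw [localInit_fst, localInit_snd]
    exact ⟨(h.init_integrable i a).1.indicator hm, (h.init_integrable i a).2.indicator hm⟩
  state_adapted := h.state_adapted
  action_adapted := h.action_adapted
  step_adapted n i a := by
    refine (h.step_adapted n i a).indicator (measurableSet_localEvent ?_ ?_ ?_ ?_)
    · exact fun z => (measurable_flatten_init h z).mono (ℱ.mono (Nat.zero_le n)) le_rfl
    · exact fun k hk i => ℱ.mono hk _ (h.state_adapted k i)
    · exact fun k hk a => ℱ.mono hk _ (h.action_adapted k a)
    · exact fun k hk i a => (h.step_adapted k i a).mono (ℱ.mono hk) le_rfl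
  coin_adapted := h.coin_adapted
  transition := h.transition

lemma measurableSet_localEvent_of_observed_le (h : IsDSORSampling M μ ℱ Q₀ X U β coin)
    {𝒢 : Filtration ℕ mΩ} (h𝒢 : h.observed ≤ 𝒢) (n : ℕ) :
    MeasurableSet[𝒢 n] (localEvent Q₀ X U β R ε N n) := by
  refine h𝒢 n _ (measurableSet_localEvent (m := observedSigma Q₀ X U β n) ?_ ?_ ?_ ?_)
  · rintro ⟨b, s, u⟩ t ht
    refine MeasurableSpace.measurableSet_generateFrom ?_
    cases b
    · exact Or.inl (Or.inl (Or.inl (Or.inr ⟨s, u, t, ht, by ext ω; simp [flatten]⟩)))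
    · exact Or.inl (Or.inl (Or.inl (Or.inl ⟨s, u, t, ht, by ext ω; simp [flatten]⟩)))
  · exact fun k hk i => MeasurableSpace.measurableSet_generateFrom
      (Or.inl (Or.inl (Or.inr ⟨k, hk, i, rfl⟩)))
  · exact fun k hk a => MeasurableSpace.measurableSet_generateFrom
      (Or.inl (Or.inr ⟨k, hk, a, rfl⟩))
  · exact fun k hk i a t ht => MeasurableSpace.measurableSet_generateFrom
      (Or.inr ⟨k, hk, i, a, t, ht, rfl⟩)

end Localisation

/-! ### Convergence of the table difference and of its conditional expectations -/

section Convergence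

variable {Ω S A : Type*} [Fintype S] [DecidableEq S] [Fintype A] [DecidableEq A]
  {M : FiniteMDP S A} {w : ℝ} {g : (A → ℝ) → A} {selB : Bool}
  {Q₀ : Ω → TablePair S A} {X : ℕ → Ω → S} {U : ℕ → Ω → A}
  {β : ℕ → Ω → S → A → ℝ} {coin : ℕ → Ω → Bool}

/-- The difference of the tables tends to `0` almost surely when the noise converges. -/
lemma tendsto_flatIterate_sub (hw0 : 0 < w) (hw : w ≤ M.wStar) (hg : IsArgmaxRule g) {ω : Ω}
    (hβ : ∀ n i a, 0 ≤ β n ω i a ∧ β n ω i a ≤ 1)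
    (hsum : ∀ i a, Tendsto (fun T : ℕ => ∑ n ∈ Finset.range T, visitStep X U β n ω i a)
      atTop atTop)
    (hnoise : ∀ z, ∃ l, Tendsto (fun n => ∑ k ∈ Finset.range n,
      dsorNoise M w g selB Q₀ X U β coin k ω z) atTop (𝓝 l))
    {R : ℝ} (hR : ∀ n, ‖flatIterate M w g selB Q₀ X U β coin n ω‖ ≤ R) (y : S × A) :
    Tendsto (fun n => flatIterate M w g selB Q₀ X U β coin n ω (false, y)
      - flatIterate M w g selB Q₀ X U β coin n ω (true, y)) atTop (𝓝 0) := by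
  set x := fun n => flatIterate M w g selB Q₀ X U β coin n ω with hx
  have hlim : Tendsto (fun n (y : S × A) => x n (false, y) - x n (true, y)) atTop (𝓝 0) := by
    refine tendsto_zero_of_contraction (κ := M.sorModulus w) (R := 2 * R)
      (a := fun n y => visitStep X U β n ω y.1 y.2 / 2)
      (f := fun n y => meanTarget M w g selB (x n) (false, y)
        - meanTarget M w g selB (x n) (true, y))
      (d := fun n y => dsorNoise M w g selB Q₀ X U β coin n ω (false, y)
        - dsorNoise M w g selB Q₀ X U β coin n ω (true, y))
      (M.sorModulus_nonneg hw0 hw y.1 y.2) (M.sorModulus_lt_one hw0) (fun n y => ?_)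
      (fun y => ?_) (fun n y => ?_) (fun n y => abs_meanTarget_sub_le M hw0 hw hg selB (x n) y)
      (fun y => ?_) (fun n => ?_)
    · have := visitStep_mem (X := X) (U := U) (hβ n) y.1 y.2
      constructor <;> linarith
    · simp only [← Finset.sum_div]
      exact (hsum y.1 y.2).atTop_div_const (by norm_num)
    · simp only [hx, flatIterate_succ, dsorNoise]
      ring
    · obtain ⟨l, hl⟩ := hnoise (false, y)
      obtain ⟨l', hl'⟩ := hnoise (true, y)
      exact ⟨l - l', by simpa only [Finset.sum_sub_distrib] using hl.sub hl'⟩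
    · have hR0 : 0 ≤ R := (norm_nonneg _).trans (hR n)
      refine (pi_norm_le_iff_of_nonneg (by linarith)).2 fun y => (norm_sub_le _ _).trans ?_
      have h1 := (norm_le_pi_norm (x n) (false, y)).trans (hR n)
      have h2 := (norm_le_pi_norm (x n) (true, y)).trans (hR n)
      linarith
  exact tendsto_pi_nhds.1 hlim y

variable [mΩ : MeasurableSpace Ω] {μ : Measure Ω} [IsProbabilityMeasure μ]
  {ℱ : Filtration ℕ mΩ}

/-- At each fixed time the iterates are at most a deterministic multiple of `1` plus the initial
tables; this bound is not uniform in `n`. -/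
lemma integrable_flatIterate (h : IsDSORSampling M μ ℱ Q₀ X U β coin) (hg : IsArgmaxRule g)
    (hw0 : 0 < w) (hβ : ∀ᵐ ω ∂μ, ∀ n i a, 0 ≤ β n ω i a ∧ β n ω i a ≤ 1) (n : ℕ)
    (z : Bool × S × A) :
    Integrable (fun ω => flatIterate M w g selB Q₀ X U β coin n ω z) μ := by
  have hbound : Integrable (fun ω => (2 + targetGrowth M w) ^ n *
      (1 + ∑ z, |flatten (Q₀ ω) z|)) μ :=
    ((integrable_const (1 : ℝ)).add
      (integrable_finsetSum _ fun z _ => (integrable_flatten_init h z).abs)).const_mul _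
  refine hbound.mono' ((measurable_flatIterate h hg n z).mono (ℱ.le n)
    le_rfl).aestronglyMeasurable ?_
  filter_upwards [hβ] with ω hω
  have h1 := one_add_norm_flatIterate_le (M := M) (g := g) (selB := selB) (Q₀ := Q₀) (X := X)
    (U := U) (coin := coin) hw0 hω n
  have h2 := norm_le_pi_norm (flatIterate M w g selB Q₀ X U β coin n ω) z
  have h3 : ‖flatten (Q₀ ω)‖ ≤ ∑ z, |flatten (Q₀ ω) z| :=
    (pi_norm_le_iff_of_nonneg (Finset.sum_nonneg fun _ _ => abs_nonneg _)).2 fun z =>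
      Finset.single_le_sum (f := fun z => |flatten (Q₀ ω) z|) (fun _ _ => abs_nonneg _)
        (Finset.mem_univ z)
  have hK := targetGrowth_nonneg M hw0
  have h4 : (2 + targetGrowth M w) ^ n * (1 + ‖flatten (Q₀ ω)‖)
      ≤ (2 + targetGrowth M w) ^ n * (1 + ∑ z, |flatten (Q₀ ω) z|) := by gcongr
  linarith

/-- Convergence of the conditional expectations on the paths that never leave a local event. -/
lemma ae_tendsto_condExp_of_mem_localEvent (h : IsDSORSampling M μ ℱ Q₀ X U β coin)
    (hg : IsArgmaxRule g) (hw0 : 0 < w) (hw : w ≤ M.wStar)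
    (hβ : ∀ᵐ ω ∂μ, ∀ n i a, 0 ≤ β n ω i a ∧ β n ω i a ≤ 1)
    (hsum : ∀ᵐ ω ∂μ, ∀ i a,
      Tendsto (fun T : ℕ => ∑ n ∈ Finset.range T, visitStep X U β n ω i a) atTop atTop)
    {𝒢 : Filtration ℕ mΩ} (h𝒢 : h.observed ≤ 𝒢) {R ε : ℝ} (hR : 0 ≤ R) (hε : 0 ≤ ε)
    (hsmall : 256 * Fintype.card (Bool × S × A) * noiseGrowth M w ^ 2 * ε
      ≤ (1 - M.sorModulus w) ^ 2) (N : ℕ) (y : S × A) :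
    ∀ᵐ ω ∂μ, (∀ n, ω ∈ localEvent Q₀ X U β R ε N n) →
      Tendsto (fun n => (μ[fun ω => flatIterate M w g selB Q₀ X U β coin n ω (false, y)
        - flatIterate M w g selB Q₀ X U β coin n ω (true, y) | 𝒢 n]) ω) atTop (𝓝 0) := by
  set E := localEvent Q₀ X U β R ε N with hE
  set x := flatIterate M w g selB Q₀ X U β coin with hx
  set β' := localStep Q₀ X U β R ε N with hβ'
  set x' := flatIterate M w g selB (localInit Q₀ R) X U β' coin with hx'
  set V : ℕ → Ω → ℝ := fun n ω => x n ω (false, y) - x n ω (true, y) with hV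
  have hxx' : ∀ n, ∀ ω ∈ E n, x' n ω = x n ω := fun n ω hω => by
    rw [hx', hx, flatIterate, flatIterate, dsorIterate_local hω]
  have hscheme := isRelaxationScheme_flatIterate (selB := selB) (h.localise (R := R) (ε := ε)
    (N := N)) hg hw0 hw (fun ω n => localStep_mem n ω) (norm_flatten_localInit_le hR)
  have hκ0 := M.sorModulus_nonneg hw0 hw y.1 y.2
  have hκ1 := M.sorModulus_lt_one hw0
  have hC := mul_nonneg hw0.le M.rewardBound_nonneg
  have hK : 0 ≤ noiseGrowth M w := by
    have := targetGrowth_nonneg M hw0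
    rw [noiseGrowth]
    linarith
  have henergy := sum_stepEnergy_localStep_le (Q₀ := Q₀) (X := X) (U := U) (β := β) (R := R)
    (N := N) hε
  obtain ⟨Y, hYint, hY⟩ := hscheme.exists_integrable_bound hκ0 hκ1 hC hK henergy hsmall
  have hnoise := hscheme.ae_tendsto_noise hκ0 hκ1 hC hK henergy hsmall
  have hVint : ∀ n, Integrable (V n) μ := fun n =>
    (integrable_flatIterate h hg hw0 hβ n _).sub (integrable_flatIterate h hg hw0 hβ n _)
  have hEm : ∀ n, MeasurableSet[𝒢 n] (E n) := measurableSet_localEvent_of_observed_le h h𝒢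
  -- On `E n` the original and the localised tables coincide, which yields the domination by `2 *
  -- Y`. A path that leaves the decreasing events has indicator `0` from then on; on the others the
  -- localised step sizes still have divergent sums.
  have hhunt := tendsto_condExp_of_dominated 𝒢 (v := fun n => (E n).indicator (V n))
    (Y := fun ω => 2 * Y ω)
    (fun n => ((hVint n).indicator (𝒢.le n _ (hEm n))).aestronglyMeasurable.aemeasurable)
    (hYint.const_mul 2) (by
      filter_upwards [hY] with ω hω n
      by_cases hn : ω ∈ E n
      · rw [Set.indicator_of_mem hn]
        simp only [hV, ← hxx' n ω hn]
        have h1 := (norm_le_pi_norm (x' n ω) (false, y)).trans (hω n)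
        have h2 := (norm_le_pi_norm (x' n ω) (true, y)).trans (hω n)
        rw [Real.norm_eq_abs] at h1 h2
        refine (abs_sub _ _).trans ?_
        linarith
      · rw [Set.indicator_of_notMem hn, abs_zero]
        have := (norm_nonneg _).trans (hω n)
        linarith) (by
      filter_upwards [hY, hnoise, hsum] with ω h1 h2 h3
      by_cases hall : ∀ n, ω ∈ E n
      · have hstep : ∀ n, β' n ω = β n ω := fun n => localStep_of_mem (hall n)
        have := tendsto_flatIterate_sub (selB := selB) (Q₀ := localInit Q₀ R) (X := X) (U := U)
          (β := β') (coin := coin) (M := M) (R := Y ω) hw0 hw hg (ω := ω)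
          (fun n => localStep_mem n ω)
          (by simpa only [visitStep, hstep] using h3) h2 h1 y
        refine this.congr fun n => ?_
        rw [Set.indicator_of_mem (hall n)]
        simp only [hV, ← hxx' n ω (hall n), hx']
      · push Not at hall
        obtain ⟨n₀, hn₀⟩ := hall
        refine tendsto_const_nhds.congr' ?_
        filter_upwards [eventually_ge_atTop n₀] with n hn
        exact (Set.indicator_of_notMem (fun hω => hn₀ (localEvent_antitone hn hω)) _).symm)
  -- Observability of `E n` in `𝒢 n` is essential here: the truncated difference gives back the
  -- conditional expectation of the original one.
  have hind : ∀ᵐ ω ∂μ, ∀ n, (μ[(E n).indicator (V n) | 𝒢 n]) ω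
      = (E n).indicator (μ[V n | 𝒢 n]) ω :=
    ae_all_iff.2 fun n => condExp_indicator (hVint n) (hEm n)
  filter_upwards [hhunt, hind] with ω h1 h2 h3
  refine h1.congr fun n => ?_
  rw [h2 n, Set.indicator_of_mem (h3 n)]

end Convergence

theorem mainTheorem5 {Ω S A : Type*} [mΩ : MeasurableSpace Ω] (μ : Measure Ω)
    [IsProbabilityMeasure μ] [Fintype S] [DecidableEq S] [Fintype A] [DecidableEq A]
    (M : FiniteMDP S A) (w : ℝ) (hw_pos : 0 < w) (hw_le : w ≤ M.wStar)
    (g : (A → ℝ) → A) (hg : IsArgmaxRule g) (selB : Bool)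
    (ℱ : Filtration ℕ mΩ) (Q₀ : Ω → TablePair S A)
    (X : ℕ → Ω → S) (U : ℕ → Ω → A) (β : ℕ → Ω → S → A → ℝ) (coin : ℕ → Ω → Bool)
    (h : IsDSORSampling M μ ℱ Q₀ X U β coin)
    (hβ_mem : ∀ᵐ ω ∂μ, ∀ n i a, 0 ≤ β n ω i a ∧ β n ω i a ≤ 1)
    (hβ_sum : ∀ᵐ ω ∂μ, ∀ i a,
      Tendsto (fun N : ℕ => ∑ n ∈ Finset.range N, visitStep X U β n ω i a) atTop atTop)
    (hβ_sq : ∀ᵐ ω ∂μ, ∀ i a, Summable (fun n : ℕ => visitStep X U β n ω i a ^ 2))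
    (V : ℕ → S → A → Ω → ℝ)
    (hV : ∀ n i a ω, V n i a ω =
      (dsorIterate M w g selB Q₀ X U β coin n ω).2 i a -
        (dsorIterate M w g selB Q₀ X U β coin n ω).1 i a)
    (𝒢 : Filtration ℕ mΩ) (h𝒢 : h.observed ≤ 𝒢) (i : S) (a : A) :
    (∀ n, Integrable (V n i a) μ) ∧
      ∀ᵐ ω ∂μ, Tendsto (fun n : ℕ => (μ[V n i a | 𝒢 n]) ω) atTop (𝓝 0) := by
  have hVflat : ∀ n, V n i a = fun ω => flatIterate M w g selB Q₀ X U β coin n ω (false, i, a)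
      - flatIterate M w g selB Q₀ X U β coin n ω (true, i, a) := fun n => by
    ext ω
    simp [hV, flatIterate, flatten]
  refine ⟨fun n => ?_, ?_⟩
  · rw [hVflat]
    exact (integrable_flatIterate h hg hw_pos hβ_mem n _).sub
      (integrable_flatIterate h hg hw_pos hβ_mem n _)
  set c : ℝ := 256 * Fintype.card (Bool × S × A) * noiseGrowth M w ^ 2 with hc
  have hc0 : 0 ≤ c := by positivity
  have hκ : 0 < (1 - M.sorModulus w) ^ 2 := by
    have := sub_pos.2 (M.sorModulus_lt_one hw_pos)
    positivity
  -- Dividing by `c + 1` avoids having to show that `c` is positive.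
  set ε : ℝ := (1 - M.sorModulus w) ^ 2 / (c + 1) with hε
  have hε0 : 0 < ε := by positivity
  have hsmall : c * ε ≤ (1 - M.sorModulus w) ^ 2 := by
    rw [hε, mul_div_assoc', div_le_iff₀ (by positivity)]
    nlinarith
  -- Natural `R` and `N` keep the exceptional null sets countable in number, while `ε` is fixed once
  -- and for all.
  have hloc : ∀ᵐ ω ∂μ, ∀ R N : ℕ, (∀ n, ω ∈ localEvent Q₀ X U β R ε N n) →
      Tendsto (fun n : ℕ => (μ[V n i a | 𝒢 n]) ω) atTop (𝓝 0) := by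
    refine ae_all_iff.2 fun R => ae_all_iff.2 fun N => ?_
    simp only [hVflat]
    exact ae_tendsto_condExp_of_mem_localEvent h hg hw_pos hw_le hβ_mem hβ_sum h𝒢
      R.cast_nonneg hε0.le hsmall N (i, a)
  filter_upwards [hloc, hβ_mem, hβ_sq] with ω h1 h2 h3
  obtain ⟨R, N, hRN⟩ := exists_forall_mem_localEvent (Q₀ := Q₀) hε0 h2 h3
  exact h1 R N hRN
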